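/- Fix a finite set $\mathcal G$ of one-qubit and two-qubit unitary gates. A *quantum circuit* has $w$ witness qubits, $a$ ancilla qubits initialized to $|0\rangle$, a list of gates from $\mathcal G$, generalized Toffoli gates (any number of controls) and classical fanout gates of unbounded size, and one designated output qubit, whose measurement decides acceptance. (A fanout gate is classical if its targets are ancillas on which no gate acted before and which later gates only use as controls.) Its *weft* is the maximum number of Toffoli gates with at least two controls on a path from an input qubit to the output qubit, and its *description size* is $|C|=\max(w+a,\ \text{number of gates})$; a *weft-$t$ circuit* is one of weft at most $t$. Circuits are encoded as bit strings of length polynomial in $|C|$. Let $(c,s)$ range over the *admissible* pairs: polynomial-time computable functions $c,s:\mathbb N\to[0,1]$ with $c(m)-s(m)>1/q(m)$ for all $m$, for some polynomial $q$. A circuit $C$ is a *yes-circuit* if some witness state is accepted with probability at least $c(|C|)$, and a *no-circuit* if every witness state is accepted with probability at most $s(|C|)$. A quantum algorithm (classical control with a quantum memory) solves a task *in time $T$ with bounded error* if for every fixed $\varepsilon>0$ it can be chosen such that, on every instance that satisfies the promise, with probability at least $1-\varepsilon$ it halts within $T$ steps with the correct answer ($T$ may depend on $\varepsilon$). * A parameterized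 problem is a promise problem (disjoint sets of yes- and no-instances) with a polynomial-time computable parameter $\kappa(x)\ge 1$. It is in $\mathrm{FPQT}$ if it is decided by quantum algorithms with bounded error in time $f(\kappa(x))\,\mathrm{poly}(|x|)$ with $f$ computable. An *FPQT reduction* from $P$ to $Q$ is a map $R$ that takes yes-instances to yes-instances and no-instances to no-instances, is computed by quantum algorithms with bounded error in such time, and satisfies $\kappa_Q(R(x))\le g(\kappa_P(x))$ on all instances of $P$ for some computable $g$. * An instance of $\mathrm{Mini\text{-}QCSAT}_t(c,s)$ consists of positive integers $k,n$ in unary and a weft-$t$ circuit $C$ with $|C|\le k\log_2 n$; the parameter is $k$; the yes-instances (no-instances) are those where $C$ is a yes-circuit (no-circuit) for $(c,s)$. * $\mathrm{QM}[t]=\bigcup_{(c,s)\ \text{admissible}}\mathrm{QM}_{c,s}[t]$, where $\mathrm{QM}_{c,s}[t]$ is the class of parameterized problems that are FPQT-reducible to $\mathrm{Mini\text{-}QCSAT}_t(c,s)$. * $\mathrm{QETH}$ is the statement: for some admissible pair $(c,s)$, there are no quantum algorithms that, with bounded error and in time $2^{o(|C|)}$, distinguish the weft-$1$ yes-circuits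 $C$ from the weft-$1$ no-circuits. Here time $2^{o(m)}$ means time $2^{h(m)}$ where $h:\mathbb N\to\mathbb N$ is effectively $o(m)$: there is a computable function $M$ such that $k\,h(m)\le m$ for all $k$ and all $m\ge M(k)$. **Theorem.** $\mathrm{QM}[1]\subseteq\mathrm{FPQT}$ if and only if $\mathrm{QETH}$ is false. -/

import Mathlib

namespace QPC

noncomputable section

/-! ## Quantum algorithms

A quantum program has finitely many classical registers, each holding a bit string that is used as
a stack, and a quantum memory whose qubits are named by bit strings; almost all qubits are
`|0⟩`.  A quantum instruction acts on the qubits whose names are the current contents of registers.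
Every primitive instruction and every test costs one step. -/

/-- Quantum programs over the gate set `H`, `T`, `CNOT`. -/
inductive Prog : Type
  /-- push the bit `b` onto register `r` -/
  | push (r : ℕ) (b : Bool)
  /-- remove the top bit of register `r` (if there is one) -/
  | pop (r : ℕ)
  /-- Hadamard gate on the qubit named by register `r` -/
  | had (r : ℕ)
  /-- `T = diag(1, exp(iπ/4))` on the qubit named by register `r` -/
  | tgate (r : ℕ)
  /-- `CNOT` with the control named by register `r` and the target named by register `r'` -/
  | cnot (r r' : ℕ)
  /-- measure the qubit named by `r` in the computational basis; push the outcome onto `r'` -/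
  | measure (r r' : ℕ)
  /-- discard the quantum memory and set all its qubits to `|0⟩` again -/
  | reset
  | skip
  | seq (p q : Prog)
  /-- if the top bit of register `r` is `true` then `p` else `q` -/
  | ifTrue (r : ℕ) (p q : Prog)
  /-- while register `r` is nonempty do `p` -/
  | whileNonempty (r : ℕ) (p : Prog)

/-- A program without quantum instructions: a deterministic multi-stack machine. -/
def Prog.IsClassical : Prog → Prop
  | .push _ _ => True
  | .pop _ => True
  | .had _ => False
  | .tgate _ => False
  | .cnot _ _ => False
  | .measure _ _ => False
  | .reset => False
  | .skip => True
  | .seq p q => p.IsClassical ∧ q.IsClassical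
  | .ifTrue _ p q => p.IsClassical ∧ q.IsClassical
  | .whileNonempty _ p => p.IsClassical

/-- A (not necessarily normalized) state of the quantum memory: the basis state `S` is the one in
which exactly the qubits named in `S` are `|1⟩`. -/
abbrev QMem : Type := Finset (List Bool) →₀ ℂ

namespace QMem

/-- The all-zero state. -/
def zero : QMem := Finsupp.single ∅ 1

/-- The squared norm. -/
def normSq (ψ : QMem) : ℝ := ψ.sum fun _ a => ‖a‖ ^ 2

/-- The linear extension of a map given on basis states. -/
def lift (U : Finset (List Bool) → QMem) (ψ : QMem) : QMem := ψ.sum fun S a => a • U S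

/-- Hadamard gate on the qubit `q`. -/
def had (q : List Bool) : QMem → QMem :=
  lift fun S =>
    ((1 / Real.sqrt 2 : ℝ) : ℂ) •
      (Finsupp.single (S.erase q) 1 + Finsupp.single (insert q S) (if q ∈ S then -1 else 1))

/-- `T` gate on the qubit `q`. -/
def tgate (q : List Bool) : QMem → QMem :=
  lift fun S => Finsupp.single S (if q ∈ S then Complex.exp (Complex.I * (Real.pi / 4)) else 1)

/-- `CNOT` with control `q` and target `q'` (no effect if `q = q'`). -/
def cnot (q q' : List Bool) : QMem → QMem :=
  lift fun S =>
    Finsupp.single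
      (if q = q' ∨ q ∉ S then S else if q' ∈ S then S.erase q' else insert q' S) 1

/-- The unnormalized state after measuring the qubit `q` with outcome `b`. -/
def project (q : List Bool) (b : Bool) (ψ : QMem) : QMem :=
  ψ.filter fun S => decide (q ∈ S) = b

/-- Discard and reinitialize; the squared norm (the weight of the branch) is kept. -/
def reset (ψ : QMem) : QMem := Finsupp.single ∅ ((Real.sqrt ψ.normSq : ℝ) : ℂ)

end QMem

/-- A configuration: the programs that remain to be executed, the contents of the registers and
the quantum memory, unnormalized so that its squared norm is the probability of the branch. -/
structure Config : Type where
  todo : List Prog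
  reg : ℕ → List Bool
  mem : QMem

/-- One step; a measurement has two successors, one for each outcome. A configuration with nothing
left to execute has halted and stays as it is. -/
def step : Config → List Config
  | ⟨[], σ, ψ⟩ => [⟨[], σ, ψ⟩]
  | ⟨.push r b :: K, σ, ψ⟩ => [⟨K, Function.update σ r (b :: σ r), ψ⟩]
  | ⟨.pop r :: K, σ, ψ⟩ => [⟨K, Function.update σ r (σ r).tail, ψ⟩]
  | ⟨.had r :: K, σ, ψ⟩ => [⟨K, σ, ψ.had (σ r)⟩]
  | ⟨.tgate r :: K, σ, ψ⟩ => [⟨K, σ, ψ.tgate (σ r)⟩]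
  | ⟨.cnot r r' :: K, σ, ψ⟩ => [⟨K, σ, ψ.cnot (σ r) (σ r')⟩]
  | ⟨.measure r r' :: K, σ, ψ⟩ =>
      [⟨K, Function.update σ r' (false :: σ r'), ψ.project (σ r) false⟩,
       ⟨K, Function.update σ r' (true :: σ r'), ψ.project (σ r) true⟩]
  | ⟨.reset :: K, σ, ψ⟩ => [⟨K, σ, ψ.reset⟩]
  | ⟨.skip :: K, σ, ψ⟩ => [⟨K, σ, ψ⟩]
  | ⟨.seq p q :: K, σ, ψ⟩ => [⟨p :: q :: K, σ, ψ⟩]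
  | ⟨.ifTrue r p q :: K, σ, ψ⟩ =>
      if (σ r).head? = some true then [⟨p :: K, σ, ψ⟩] else [⟨q :: K, σ, ψ⟩]
  | ⟨.whileNonempty r p :: K, σ, ψ⟩ =>
      if σ r = [] then [⟨K, σ, ψ⟩] else [⟨p :: .whileNonempty r p :: K, σ, ψ⟩]

/-- All branches after `T` steps. -/
def steps : ℕ → Config → List Config
  | 0, κ => [κ]
  | T + 1, κ => (step κ).flatMap (steps T)

/-- The initial configuration: the input is in register `0`, all other registers are empty, all
qubits are `|0⟩`. -/
def Prog.init (p : Prog) (x : List Bool) : Config :=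
  ⟨[p], Function.update (fun _ => []) 0 x, QMem.zero⟩

/-- `p.outProb x T y` is the probability that `p` on input `x` halts within `T` steps with output
`y`. The output is the content of register `1`. -/
def Prog.outProb (p : Prog) (x : List Bool) (T : ℕ) (y : List Bool) : ℝ :=
  ((steps T (p.init x)).map fun κ =>
    if κ.todo = [] ∧ κ.reg 1 = y then κ.mem.normSq else 0).sum

/-! ## Parameterized promise problems, fixed-parameter quantum tractability, reductions -/

/-- A promise problem over the binary alphabet together with a parameter. -/
structure ParamProblem : Type where
  yes : Set (List Bool)
  no : Set (List Bool)
  param : List Bool → ℕ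

/-- `g` is computed by a classical program in polynomial time (values are written in binary, least
significant bit first). -/
def PolyTimeComputable (g : List Bool → ℕ) : Prop :=
  ∃ (p : Prog) (q : Polynomial ℕ), p.IsClassical ∧
    ∀ x, p.outProb x (q.eval x.length) (Nat.bits (g x)) = 1

/-- The conditions on a parameterized (promise) problem: no string is both a yes- and a no-instance,
and the parameter is positive and computable in polynomial time. -/
def ParamProblem.WellFormed (P : ParamProblem) : Prop :=
  Disjoint P.yes P.no ∧ (∀ x, 0 < P.param x) ∧ PolyTimeComputable P.param

/-- The parameterized problems that are decided by bounded-error quantum programs in time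
`f(param) * poly(length)` with `f` computable; the error can be made smaller than any given
positive constant. -/
def FPQT : Set ParamProblem :=
  {P | P.WellFormed ∧ ∀ ε : ℝ, 0 < ε →
    ∃ (p : Prog) (f : ℕ → ℕ) (q : Polynomial ℕ), Computable f ∧
      (∀ x ∈ P.yes, 1 - ε ≤ p.outProb x (f (P.param x) * q.eval x.length) [true]) ∧
      (∀ x ∈ P.no, 1 - ε ≤ p.outProb x (f (P.param x) * q.eval x.length) [false])}

/-- FPQT reductions: a map of instances that preserves yes- and no-instances, bounds the new
parameter by a computable function of the old one, and is computed with bounded error by a quantum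
program in fixed-parameter time. -/
def FPQTReducible (P Q : ParamProblem) : Prop :=
  ∃ (R : List Bool → List Bool) (g : ℕ → ℕ), Computable g ∧
    (∀ x ∈ P.yes, R x ∈ Q.yes) ∧ (∀ x ∈ P.no, R x ∈ Q.no) ∧
    (∀ x ∈ P.yes ∪ P.no, Q.param (R x) ≤ g (P.param x)) ∧
    ∀ ε : ℝ, 0 < ε →
      ∃ (p : Prog) (f : ℕ → ℕ) (q : Polynomial ℕ), Computable f ∧
        ∀ x ∈ P.yes ∪ P.no, 1 - ε ≤ p.outProb x (f (P.param x) * q.eval x.length) (R x)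

/-! ## Quantum circuits with generalized Toffoli gates and classical fanout -/

/-- A finite set of one-qubit and two-qubit unitary gates. -/
structure GateSet : Type where
  num₁ : ℕ
  num₂ : ℕ
  U₁ : Fin num₁ → Matrix.unitaryGroup Bool ℂ
  U₂ : Fin num₂ → Matrix.unitaryGroup (Bool × Bool) ℂ

/-- Gates on `n` wires. -/
inductive Gate (𝒢 : GateSet) (n : ℕ) : Type
  | one (i : Fin 𝒢.num₁) (q : Fin n)
  | two (i : Fin 𝒢.num₂) (q r : Fin n)
  /-- flip the target if all controls are `1` -/
  | toffoli (controls : List (Fin n)) (target : Fin n)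
  /-- add the control bit to all targets -/
  | fanout (control : Fin n) (targets : List (Fin n))

namespace Gate

variable {𝒢 : GateSet} {n : ℕ}

/-- The wires that a gate acts on. -/
def wires : Gate 𝒢 n → List (Fin n)
  | one _ q => [q]
  | two _ q r => [q, r]
  | toffoli cs t => t :: cs
  | fanout c ts => c :: ts

/-- The wires of a gate are pairwise distinct. -/
def Proper (g : Gate 𝒢 n) : Prop := g.wires.Nodup

/-- The generalized Toffoli gates that count for the weft. With fewer than two controls a Toffoli
gate is just a one-qubit or two-qubit gate (`X` or `CNOT`). -/
def isToffoli : Gate 𝒢 n → Bool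
  | toffoli cs _ => decide (2 ≤ cs.length)
  | _ => false

/-- The gate `g` does not act on the wire `q`, or acts on it only by using it as a control. For a
two-qubit gate this means that the gate is `|0⟩⟨0| ⊗ A + |1⟩⟨1| ⊗ B` with respect to this wire. -/
def OnlyControl (g : Gate 𝒢 n) (q : Fin n) : Prop :=
  match g with
  | one _ q' => q ≠ q'
  | two i q₁ q₂ =>
      (q = q₁ → ∀ a b : Bool × Bool, a.1 ≠ b.1 → (𝒢.U₂ i : Matrix _ _ ℂ) a b = 0) ∧
      (q = q₂ → ∀ a b : Bool × Bool, a.2 ≠ b.2 → (𝒢.U₂ i : Matrix _ _ ℂ) a b = 0)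
  | toffoli _ t => q ≠ t
  | fanout _ ts => q ∉ ts

/-- The action of a (proper) gate on the vector of amplitudes. -/
def apply (g : Gate 𝒢 n) (ψ : (Fin n → Bool) → ℂ) : (Fin n → Bool) → ℂ :=
  match g with
  | one i q => fun x =>
      ∑ b : Bool, (𝒢.U₁ i : Matrix _ _ ℂ) (x q) b * ψ (Function.update x q b)
  | two i q r => fun x =>
      ∑ b : Bool × Bool, (𝒢.U₂ i : Matrix _ _ ℂ) (x q, x r) b *
        ψ (Function.update (Function.update x q b.1) r b.2)
  | toffoli cs t => fun x => ψ (if ∀ c ∈ cs, x c = true then Function.update x t (!x t) else x)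
  | fanout c ts => fun x => ψ (fun j => if j ∈ ts then xor (x j) (x c) else x j)

/-- How the largest number of Toffoli gates on a path that ends in a given wire changes when a gate
is appended. -/
def pathStep (ℓ : Fin n → ℕ) (g : Gate 𝒢 n) : Fin n → ℕ := fun q =>
  if q ∈ g.wires then (g.wires.toFinset.sup ℓ) + (if g.isToffoli then 1 else 0) else ℓ q

end Gate

/-- A quantum circuit: the first `witness` wires carry the input state, the other `ancilla` wires
start in `|0⟩`, and the circuit accepts if measuring the wire `out` at the end yields `1`. -/
structure Circuit (𝒢 : GateSet) : Type where
  witness : ℕ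
  ancilla : ℕ
  gates : List (Gate 𝒢 (witness + ancilla))
  out : Fin (witness + ancilla)

namespace Circuit

variable {𝒢 : GateSet}

/-- The total description size: the least bound for the number of input wires (ancillas included)
and the number of gates. -/
def size (C : Circuit 𝒢) : ℕ := max (C.witness + C.ancilla) C.gates.length

/-- All gates are proper, and every fanout gate is classical: its targets are ancillas on which no
gate acted before, and afterwards they are only used as controls. -/
def Valid (C : Circuit 𝒢) : Prop :=
  (∀ g ∈ C.gates, g.Proper) ∧
  ∀ pre post c ts, C.gates = pre ++ Gate.fanout c ts :: post →
    ∀ t ∈ ts, C.witness ≤ t.val ∧ (∀ g ∈ pre, t ∉ g.wires) ∧ ∀ g ∈ post, g.OnlyControl t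

/-- The largest number of Toffoli gates on a path from an input wire to the output qubit. -/
def weft (C : Circuit 𝒢) : ℕ := C.gates.foldl Gate.pathStep (fun _ => 0) C.out

/-- The state `|ψ⟩|0…0⟩`. -/
def initial (C : Circuit 𝒢) (ψ : EuclideanSpace ℂ (Fin C.witness → Bool)) :
    (Fin (C.witness + C.ancilla) → Bool) → ℂ := fun x =>
  if ∀ j, x (Fin.natAdd C.witness j) = false then ψ (fun i => x (Fin.castAdd C.ancilla i)) else 0

/-- The probability that the circuit accepts the witness state `ψ`. -/
def acceptProb (C : Circuit 𝒢) (ψ : EuclideanSpace ℂ (Fin C.witness → Bool)) : ℝ :=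
  ∑ x : Fin (C.witness + C.ancilla) → Bool,
    if x C.out = true then ‖C.gates.foldl (fun φ g => g.apply φ) (C.initial ψ) x‖ ^ 2 else 0

/-- Some witness state is accepted with probability at least `c`, where `c` may depend on the
description size. -/
def IsYes (C : Circuit 𝒢) (c : ℕ → unitInterval) : Prop :=
  ∃ ψ : EuclideanSpace ℂ (Fin C.witness → Bool), ‖ψ‖ = 1 ∧ (c C.size : ℝ) ≤ C.acceptProb ψ

/-- Every witness state is accepted with probability at most `s`. -/
def IsNo (C : Circuit 𝒢) (s : ℕ → unitInterval) : Prop :=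
  ∀ ψ : EuclideanSpace ℂ (Fin C.witness → Bool), ‖ψ‖ = 1 → C.acceptProb ψ ≤ (s C.size : ℝ)

end Circuit

/-! ## Encodings (prefix codes; numbers in unary) -/

/-- `1^n 0` -/
def encNat (n : ℕ) : List Bool := List.replicate n true ++ [false]

/-- The length of the list, then the entries. -/
def encFins {n : ℕ} (l : List (Fin n)) : List Bool :=
  encNat l.length ++ l.flatMap fun i => encNat i.val

/-- The code of a gate: a tag, then the arguments. -/
def Gate.encode {𝒢 : GateSet} {n : ℕ} : Gate 𝒢 n → List Bool
  | .one i q => encNat 0 ++ encNat i.val ++ encNat q.val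
  | .two i q r => encNat 1 ++ encNat i.val ++ encNat q.val ++ encNat r.val
  | .toffoli cs t => encNat 2 ++ encNat t.val ++ encFins cs
  | .fanout c ts => encNat 3 ++ encNat c.val ++ encFins ts

/-- The code of a circuit. -/
def Circuit.encode {𝒢 : GateSet} (C : Circuit 𝒢) : List Bool :=
  encNat C.witness ++ encNat C.ancilla ++ encNat C.out.val ++ encNat C.gates.length ++
    C.gates.flatMap Gate.encode

/-! ## Miniaturized quantum circuit satisfiability, `QM[t]` and `QETH` -/

/-- `c : ℕ → [0,1]` is computable in polynomial time: from `n` and `m` in unary a classical program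
computes in time polynomial in `n + m` the numerator of an approximation of `c n` with denominator
`2 ^ m` and error at most `2 ^ (-m)`. -/
def PolyTimeThreshold (c : ℕ → unitInterval) : Prop :=
  ∃ (A : ℕ → ℕ → ℕ) (p : Prog) (q : Polynomial ℕ), p.IsClassical ∧ ∀ n m,
    |(c n : ℝ) - (A n m : ℝ) / 2 ^ m| ≤ 1 / 2 ^ m ∧
    p.outProb (encNat n ++ encNat m) (q.eval (n + m)) (Nat.bits (A n m)) = 1

/-- `c - s > 1 / poly(n)`. -/
def PolyGap (c s : ℕ → unitInterval) : Prop :=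
  ∃ q : Polynomial ℕ, ∀ n, 0 < q.eval n ∧
    1 / ((q.eval n : ℕ) : ℝ) < (c n : ℝ) - (s n : ℝ)

/-- The admissible pairs of completeness and soundness: polynomial-time computable functions with an
inverse polynomial gap. -/
def Admissible (c s : ℕ → unitInterval) : Prop :=
  PolyTimeThreshold c ∧ PolyTimeThreshold s ∧ PolyGap c s

/-- `x` encodes positive integers `k`, `n` (in unary) and a valid circuit of weft at most `t` and
description size at most `k log n`. -/
def MiniInstance (𝒢 : GateSet) (t : ℕ) (x : List Bool) (k n : ℕ) (C : Circuit 𝒢) : Prop :=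
  x = encNat k ++ encNat n ++ C.encode ∧ 0 < k ∧ 0 < n ∧ C.Valid ∧ C.weft ≤ t ∧
    (C.size : ℝ) ≤ k * Real.logb 2 n

/-- `Mini-QCSAT_t(c,s)`; the parameter is `k`, that is, the number of leading ones of the input
(set to `1` on strings that start with `0` or are empty). -/
def miniQCSAT (𝒢 : GateSet) (t : ℕ) (c s : ℕ → unitInterval) : ParamProblem where
  yes := {x | ∃ k n C, MiniInstance 𝒢 t x k n C ∧ C.IsYes c}
  no := {x | ∃ k n C, MiniInstance 𝒢 t x k n C ∧ C.IsNo s}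
  param := fun x => max 1 (x.takeWhile id).length

/-- `QM_{c,s}[t]`. -/
def QMcs (𝒢 : GateSet) (t : ℕ) (c s : ℕ → unitInterval) : Set ParamProblem :=
  {P | P.WellFormed ∧ FPQTReducible P (miniQCSAT 𝒢 t c s)}

/-- `QM[t]`: the union over all admissible pairs. -/
def QM (𝒢 : GateSet) (t : ℕ) : Set ParamProblem :=
  {P | ∃ c s : ℕ → unitInterval, Admissible c s ∧ P ∈ QMcs 𝒢 t c s}

/-- `h(n) = o(n)` effectively: from a point `M k` on that is computable from `k`, `h(n) ≤ n / k`. -/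
def EffLittleO (h : ℕ → ℕ) : Prop :=
  ∃ M : ℕ → ℕ, Computable M ∧ ∀ k n, M k ≤ n → k * h n ≤ n

/-- Quantum circuit satisfiability with completeness `c` and soundness `s` for weft-1 circuits is
decided by bounded-error quantum programs in time `2^{o(n)}`, with `n` the description size. -/
def SubexpSolvable (𝒢 : GateSet) (c s : ℕ → unitInterval) : Prop :=
  ∀ ε : ℝ, 0 < ε →
    ∃ (p : Prog) (h : ℕ → ℕ), EffLittleO h ∧
      ∀ C : Circuit 𝒢, C.Valid → C.weft ≤ 1 →
        (C.IsYes c → 1 - ε ≤ p.outProb C.encode (2 ^ h C.size) [true]) ∧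
        (C.IsNo s → 1 - ε ≤ p.outProb C.encode (2 ^ h C.size) [false])

/-- The quantum exponential time hypothesis. -/
def QETH (𝒢 : GateSet) : Prop :=
  ∃ c s : ℕ → unitInterval, Admissible c s ∧ ¬ SubexpSolvable 𝒢 c s

end

end QPC

/-! Write m for the size of a circuit C, up to a constant factor.

If QM[1] lies in FPQT, then Mini-QCSAT itself, which is in QM[1] by the identity reduction, has an
algorithm with running time f(k) times a polynomial. Given C, choose a parameter k that grows so
slowly with m that f(k) ≤ m + f(1), and pad with n = 2^e, where e = ⌈m/k⌉. Then |C| ≤ k log n, so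
(k, n, C) is an instance, and the algorithm takes time poly(m) · 2^(O(m/k)). This is 2^(o(m))
effectively, provided that k exceeds any given bound from a computable point on. The delicate point
is that k has to be found by a program of the model within this time, although f is merely
computable. `exists_slow` replaces f by a primitive recursive slow inverse K, obtained from
step-bounded evaluation of f. `exists_computes` computes K by counter programs in primitive
recursive time, `Run.exec` runs these under a clock, and `exec_slowLoop` evaluates K at 0, 1, 2, …
until a clock of m ticks runs down. As the running time of K is primitive recursive, the point at
which k passes a given bound is computable. `exists_prepare` and `two_pow_slowExponent_ge` collect
the result.

Conversely, let P reduce to Mini-QCSAT and let weft-1 circuits be decided in time 2^(h(m)) with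
k·h(m) ≤ m for m ≥ M(k). Run the reduction, extract the circuit, reset the quantum memory and run
the subexponential algorithm (`outProb_compose`). If m ≥ M(k), then h(m) ≤ m/k ≤ log n, so the
second phase takes at most n steps; and n, being written in unary, is bounded by the input length
plus the time of the first phase. If m < M(k), the time is bounded by a computable function of k
(`two_pow_le_of_effLittleO`), and k is bounded in terms of the old parameter. -/

namespace QPC

/-! ## Deterministic timed execution -/

theorem steps_add (a b : ℕ) (κ : Config) :
    steps (a + b) κ = (steps a κ).flatMap (steps b) := by
  induction a generalizing κ with
  | zero => simp [steps]
  | succ a ih =>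
    rw [Nat.succ_add]
    simp only [steps, List.flatMap_assoc]
    congr 1
    funext κ'
    exact ih κ'

/-- The program `p` deterministically turns the registers `σ` into `σ'` in at most `B` steps and
does not touch the quantum memory. -/
def Exec (p : Prog) (σ σ' : ℕ → List Bool) (B : ℕ) : Prop :=
  ∃ T ≤ B, ∀ K ψ, steps T ⟨p :: K, σ, ψ⟩ = [⟨K, σ', ψ⟩]

namespace Exec

variable {p q : Prog} {σ σ' σ₁ σ₂ τ : ℕ → List Bool} {a b B r : ℕ}

theorem mono (h : Exec p σ σ' a) (hab : a ≤ b) : Exec p σ σ' b := by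
  obtain ⟨T, hT, h⟩ := h
  exact ⟨T, hT.trans hab, h⟩

theorem congr (h : Exec p σ σ' a) (e : σ' = τ) (hab : a ≤ b) : Exec p σ τ b :=
  e ▸ h.mono hab

theorem skip : Exec .skip σ σ 1 := ⟨1, le_rfl, fun K ψ => by simp [steps, step]⟩

theorem push (r : ℕ) (c : Bool) : Exec (.push r c) σ (Function.update σ r (c :: σ r)) 1 :=
  ⟨1, le_rfl, fun K ψ => by simp [steps, step]⟩

theorem pop (r : ℕ) : Exec (.pop r) σ (Function.update σ r (σ r).tail) 1 :=
  ⟨1, le_rfl, fun K ψ => by simp [steps, step]⟩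

theorem seq (h₁ : Exec p σ σ₁ a) (h₂ : Exec q σ₁ σ₂ b) : Exec (.seq p q) σ σ₂ (a + b + 1) := by
  obtain ⟨S, hS, h₁⟩ := h₁
  obtain ⟨T, hT, h₂⟩ := h₂
  refine ⟨S + T + 1, by omega, fun K ψ => ?_⟩
  simp [steps, step, steps_add, h₁, h₂]

theorem ifTrue_pos (hr : (σ r).head? = some true) (h : Exec p σ σ' a) :
    Exec (.ifTrue r p q) σ σ' (a + 1) := by
  obtain ⟨T, hT, h⟩ := h
  exact ⟨T + 1, by omega, fun K ψ => by simp [steps, step, hr, h]⟩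

theorem ifTrue_neg (hr : (σ r).head? ≠ some true) (h : Exec q σ σ' a) :
    Exec (.ifTrue r p q) σ σ' (a + 1) := by
  obtain ⟨T, hT, h⟩ := h
  exact ⟨T + 1, by omega, fun K ψ => by simp [steps, step, hr, h]⟩

theorem while_nil (hr : σ r = []) : Exec (.whileNonempty r p) σ σ 1 :=
  ⟨1, le_rfl, fun K ψ => by simp [steps, step, hr]⟩

theorem while_cons (hr : σ r ≠ []) (h₁ : Exec p σ σ₁ a)
    (h₂ : Exec (.whileNonempty r p) σ₁ σ₂ b) :
    Exec (.whileNonempty r p) σ σ₂ (a + b + 1) := by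
  obtain ⟨S, hS, h₁⟩ := h₁
  obtain ⟨T, hT, h₂⟩ := h₂
  refine ⟨S + T + 1, by omega, fun K ψ => ?_⟩
  simp [steps, step, steps_add, h₁, h₂, hr]

end Exec

/-! ## Elementary programs -/

/-- Empty the register `r`. -/
def clear (r : ℕ) : Prog := .whileNonempty r (.pop r)

theorem exec_clear (r : ℕ) (σ : ℕ → List Bool) :
    Exec (clear r) σ (Function.update σ r []) (2 * (σ r).length + 1) := by
  generalize hl : σ r = l
  induction l generalizing σ with
  | nil =>
    refine (Exec.while_nil hl).congr ?_ (by simp)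
    rw [← hl, Function.update_eq_self]
  | cons b l ih =>
    refine (Exec.while_cons (by simp [hl]) (Exec.pop r) (ih _ (by simp [hl]))).congr ?_ ?_
    · simp
    · simp; omega

/-- Pop the bits of `r` one by one, running `p` or `q` according to the bit. -/
def forBits (r : ℕ) (p q : Prog) : Prog :=
  .whileNonempty r (.ifTrue r (.seq (.pop r) p) (.seq (.pop r) q))

/-- Move the contents of `r`, reversed, on top of `r'`. -/
def moveRev (r r' : ℕ) : Prog := forBits r (.push r' true) (.push r' false)

theorem exec_moveRev {r r' : ℕ} (hne : r ≠ r') (σ : ℕ → List Bool) :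
    Exec (moveRev r r') σ
      (Function.update (Function.update σ r' ((σ r).reverse ++ σ r')) r [])
      (5 * (σ r).length + 1) := by
  generalize hl : σ r = l
  induction l generalizing σ with
  | nil =>
    refine (Exec.while_nil hl).congr ?_ (by simp)
    ext1 j
    simp only [Function.update_apply]
    split_ifs <;> simp_all
  | cons b l ih =>
    have key : ∀ c : Bool, Exec (.seq (.pop r) (.push r' c)) σ
        (Function.update (Function.update σ r l) r' (c :: σ r')) 3 := fun c => by
      refine ((Exec.pop r).seq (Exec.push r' c)).congr ?_ le_rfl
      simp [hl, Function.update_of_ne hne.symm]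
    have body : Exec (.ifTrue r (.seq (.pop r) (.push r' true)) (.seq (.pop r) (.push r' false))) σ
        (Function.update (Function.update σ r l) r' (b :: σ r')) 4 := by
      cases b
      · exact Exec.ifTrue_neg (by simp [hl]) (key _)
      · exact Exec.ifTrue_pos (by simp [hl]) (key _)
    refine (Exec.while_cons (by simp [hl]) body (ih _ ?_)).congr ?_ ?_
    · simp [Function.update_of_ne hne]
    · ext1 j
      simp only [Function.update_apply]
      split_ifs <;> simp_all
    · simp; omega

/-- The registers `σ` with `x` in register `0` and all others empty. -/
def inputRegs (x : List Bool) : ℕ → List Bool := Function.update (fun _ => []) 0 x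

/-- Empty the registers `a, …, a + n - 1`. -/
def clearRange (a : ℕ) : ℕ → Prog
  | 0 => .skip
  | n + 1 => .seq (clearRange a n) (clear (a + n))

theorem exec_clearRange (a n L : ℕ) (σ : ℕ → List Bool) (hL : ∀ r, (σ r).length ≤ L) :
    Exec (clearRange a n) σ (fun r => if a ≤ r ∧ r < a + n then [] else σ r)
      (n * (2 * L + 2) + 1) := by
  induction n with
  | zero =>
    refine Exec.skip.congr ?_ (by simp)
    ext1 r
    rw [if_neg (by omega)]
  | succ n ih =>
    refine (ih.seq (exec_clear (a + n) _)).congr ?_ ?_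
    · ext1 r
      simp only [Function.update_apply]
      split_ifs <;> first | rfl | omega
    · have : ¬ (a ≤ a + n ∧ a + n < a + n) := by omega
      simp only [this, if_false]
      have := hL (a + n)
      rw [Nat.add_mul]
      omega

/-! ## Output probabilities -/

namespace QMem

theorem normSq_nonneg (ψ : QMem) : 0 ≤ ψ.normSq :=
  Finset.sum_nonneg fun _ _ => by positivity

theorem normSq_smul (a : ℂ) (ψ : QMem) : normSq (a • ψ) = ‖a‖ ^ 2 * ψ.normSq := by
  unfold normSq
  rw [Finsupp.sum_smul_index (by simp), Finsupp.sum, Finsupp.sum, Finset.mul_sum]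
  simp [mul_pow]

theorem normSq_zero : normSq zero = 1 := by simp [normSq, zero]

theorem lift_smul (U : Finset (List Bool) → QMem) (a : ℂ) (ψ : QMem) :
    lift U (a • ψ) = a • lift U ψ := by
  unfold lift
  rw [Finsupp.sum_smul_index (by simp), Finsupp.smul_sum]
  simp [mul_smul]

theorem reset_eq (ψ : QMem) : ψ.reset = ((Real.sqrt ψ.normSq : ℝ) : ℂ) • zero := by
  simp [reset, zero]

/-- `reset` is not linear, as it keeps only the norm. Homogeneity for nonnegative real factors
survives and suffices for `haltWeight_smul`. -/
theorem reset_smul {a : ℝ} (ha : 0 ≤ a) (ψ : QMem) :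
    reset ((a : ℂ) • ψ) = (a : ℂ) • ψ.reset := by
  rw [reset_eq, reset_eq, normSq_smul, Complex.norm_real, Real.norm_of_nonneg ha,
    Real.sqrt_mul (by positivity), Real.sqrt_sq ha, smul_smul]
  push_cast
  rfl

theorem project_smul (a : ℂ) (q : List Bool) (b : Bool) (ψ : QMem) :
    project q b (a • ψ) = a • project q b ψ := by
  unfold project
  exact Finsupp.filter_smul ..

end QMem

open Classical in
/-- The weight of the branches from `κ` that have halted after `T` steps with registers in `G`. -/
noncomputable def haltWeight (G : (ℕ → List Bool) → Prop) (T : ℕ) (κ : Config) : ℝ :=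
  ((steps T κ).map fun κ' => if κ'.todo = [] ∧ G κ'.reg then κ'.mem.normSq else 0).sum

theorem outProb_eq_haltWeight (p : Prog) (x : List Bool) (T : ℕ) (y : List Bool) :
    p.outProb x T y = haltWeight (fun σ => σ 1 = y) T ⟨[p], inputRegs x, QMem.zero⟩ := by
  unfold Prog.outProb haltWeight Prog.init inputRegs
  congr 2
  funext κ
  congr

theorem haltWeight_nonneg (G : (ℕ → List Bool) → Prop) (T : ℕ) (κ : Config) :
    0 ≤ haltWeight G T κ := by
  refine List.sum_nonneg fun w hw => ?_
  obtain ⟨κ', -, rfl⟩ := List.mem_map.1 hw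
  split_ifs
  exacts [QMem.normSq_nonneg _, le_rfl]

theorem haltWeight_succ (G : (ℕ → List Bool) → Prop) (T : ℕ) (κ : Config) :
    haltWeight G (T + 1) κ = ((step κ).map (haltWeight G T)).sum := by
  simp only [haltWeight, steps, List.map_flatMap]
  induction step κ with
  | nil => rfl
  | cons κ' l ih =>
    simp only [List.flatMap_cons, List.sum_append, ih, List.map_cons, List.sum_cons]
    rfl

theorem haltWeight_halted {G : (ℕ → List Bool) → Prop} {T : ℕ} {σ : ℕ → List Bool} {ψ : QMem} :
    haltWeight G T ⟨[], σ, ψ⟩ = haltWeight G 0 ⟨[], σ, ψ⟩ := by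
  induction T with
  | zero => rfl
  | succ T ih => simp [haltWeight_succ, step, ih]

/-- A halted branch stays as it is, so its weight is never lost. This allows all time bounds to be
upper bounds only. -/
theorem haltWeight_mono (G : (ℕ → List Bool) → Prop) {S T : ℕ} (h : S ≤ T) (κ : Config) :
    haltWeight G S κ ≤ haltWeight G T κ := by
  induction S generalizing T κ with
  | zero =>
    obtain ⟨K, σ, ψ⟩ := κ
    cases K with
    | nil => exact haltWeight_halted.ge
    | cons p K => simpa [haltWeight, steps] using haltWeight_nonneg G T ⟨p :: K, σ, ψ⟩
  | succ S ih =>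
    obtain ⟨T, rfl⟩ : ∃ T', T = T' + 1 := ⟨T - 1, by omega⟩
    rw [haltWeight_succ, haltWeight_succ]
    exact List.sum_le_sum fun κ' _ => ih (by omega) κ'

theorem outProb_mono (p : Prog) (x y : List Bool) {S T : ℕ} (h : S ≤ T) :
    p.outProb x S y ≤ p.outProb x T y := by
  rw [outProb_eq_haltWeight, outProb_eq_haltWeight]
  exact haltWeight_mono _ h _

theorem Exec.haltWeight_le {p : Prog} {σ σ' : ℕ → List Bool} {B : ℕ} (h : Exec p σ σ' B)
    (G : (ℕ → List Bool) → Prop) (T : ℕ) (K : List Prog) (ψ : QMem) :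
    haltWeight G T ⟨K, σ', ψ⟩ ≤ haltWeight G (B + T) ⟨p :: K, σ, ψ⟩ := by
  obtain ⟨S, hS, h⟩ := h
  refine le_trans (le_of_eq ?_) (haltWeight_mono G (Nat.add_le_add_right hS T) _)
  simp [haltWeight, steps_add, h]

/-- Running `p` after a deterministic preparation of its input. -/
theorem Exec.outProb_seq_le {p q : Prog} {x x' : List Bool} {B : ℕ}
    (h : Exec p (inputRegs x) (inputRegs x') B) (T : ℕ) (y : List Bool) :
    q.outProb x' T y ≤ (Prog.seq p q).outProb x (B + T + 1) y := by
  rw [outProb_eq_haltWeight, outProb_eq_haltWeight, haltWeight_succ]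
  simpa [step] using h.haltWeight_le _ T [q] QMem.zero

theorem Exec.outProb_eq_one {p : Prog} {x : List Bool} {σ : ℕ → List Bool} {B : ℕ}
    (h : Exec p (inputRegs x) σ B) : p.outProb x B (σ 1) = 1 := by
  obtain ⟨S, hS, h⟩ := h
  obtain ⟨d, rfl⟩ := Nat.exists_eq_add_of_le hS
  have hd : ∀ d, steps d ⟨[], σ, QMem.zero⟩ = [⟨[], σ, QMem.zero⟩] := fun d => by
    induction d with
    | zero => rfl
    | succ d ih => simp [steps, step, ih]
  simp only [Prog.outProb, Prog.init]
  rw [show Function.update (fun _ => []) 0 x = inputRegs x from rfl, steps_add, h]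
  simp [hd, QMem.normSq_zero]

/-- Scaling the quantum memory scales all weights. -/
theorem haltWeight_smul (G : (ℕ → List Bool) → Prop) {a : ℝ} (ha : 0 ≤ a) (T : ℕ)
    (K : List Prog) (σ : ℕ → List Bool) (ψ : QMem) :
    haltWeight G T ⟨K, σ, (a : ℂ) • ψ⟩ = a ^ 2 * haltWeight G T ⟨K, σ, ψ⟩ := by
  induction T generalizing K σ ψ with
  | zero =>
    have : QMem.normSq ((a : ℂ) • ψ) = a ^ 2 * ψ.normSq := by
      rw [QMem.normSq_smul, Complex.norm_real, Real.norm_of_nonneg ha]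
    simp only [haltWeight, steps, List.map_cons, List.map_nil, List.sum_cons, List.sum_nil, this]
    split_ifs <;> simp
  | succ T ih =>
    rw [haltWeight_succ, haltWeight_succ]
    rcases K with _ | ⟨p, K⟩
    · simp only [step, List.map_cons, List.map_nil, List.sum_cons, List.sum_nil, ih, add_zero]
    · cases p <;>
        simp only [step, List.map_cons, List.map_nil, List.sum_cons, List.sum_nil, ih, add_zero,
          QMem.had, QMem.tgate, QMem.cnot, QMem.lift_smul, QMem.project_smul,
          QMem.reset_smul ha, mul_add] <;>
        split_ifs <;> simp only [List.map_cons, List.map_nil, List.sum_cons, List.sum_nil, ih, add_zero]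

/-- Sequential composition: if `K` succeeds with probability at least `δ` from every state of the
registers in which the execution of `L` may end, then `L` followed by `K` succeeds with probability
at least `δ` times the probability of the former. -/
theorem haltWeight_append {G H I : (ℕ → List Bool) → Prop} {δ : ℝ} {T : ℕ} {K : List Prog}
    (hK : ∀ σ ψ, G σ → I σ → δ * ψ.normSq ≤ haltWeight H T ⟨K, σ, ψ⟩) (S : ℕ) (L : List Prog)
    (σ : ℕ → List Bool) (ψ : QMem) (hI : ∀ κ ∈ steps S ⟨L, σ, ψ⟩, I κ.reg) :
    δ * haltWeight G S ⟨L, σ, ψ⟩ ≤ haltWeight H (S + T) ⟨L ++ K, σ, ψ⟩ := by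
  -- A branch on which `L` halts early hands its unused steps to `K`, where monotonicity absorbs
  -- them.
  have halt : ∀ S σ ψ, I σ → δ * haltWeight G S ⟨[], σ, ψ⟩ ≤ haltWeight H (S + T) ⟨K, σ, ψ⟩ := by
    intro S σ ψ hI
    rw [haltWeight_halted]
    refine le_trans ?_ (haltWeight_mono H (Nat.le_add_left T S) _)
    by_cases hG : G σ
    · simpa [haltWeight, steps, hG] using hK σ ψ hG hI
    · simpa [haltWeight, steps, hG] using haltWeight_nonneg ..
  have hstep : ∀ (p : Prog) L σ ψ, step ⟨p :: L ++ K, σ, ψ⟩ =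
      (step ⟨p :: L, σ, ψ⟩).map fun κ => ⟨κ.todo ++ K, κ.reg, κ.mem⟩ := by
    intro p L σ ψ
    cases p <;> simp only [step, List.cons_append, List.map_cons, List.map_nil] <;>
      split_ifs <;> simp
  have hnil : ∀ S σ ψ, steps S ⟨[], σ, ψ⟩ = [⟨[], σ, ψ⟩] := fun S σ ψ => by
    induction S with
    | zero => rfl
    | succ S ih => simp [steps, step, ih]
  induction S generalizing L σ ψ with
  | zero =>
    cases L with
    | nil => exact halt 0 σ ψ (hI ⟨[], σ, ψ⟩ (by simp [steps]))
    | cons p L => simpa [haltWeight, steps] using haltWeight_nonneg ..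
  | succ S ih =>
    cases L with
    | nil => exact halt _ σ ψ (hI ⟨[], σ, ψ⟩ (by simp [hnil]))
    | cons p L =>
      rw [Nat.succ_add, haltWeight_succ, haltWeight_succ, hstep, List.map_map,
        ← List.sum_map_mul_left]
      refine List.sum_le_sum fun κ hκ => ?_
      exact ih κ.todo κ.reg κ.mem fun κ' h' => hI κ' (List.mem_flatMap.2 ⟨κ, hκ, h'⟩)

end QPC

namespace QPC

/-! ## Counter programs -/

/-- Programs for a machine with counters. -/
inductive Cm : Type
  | skip
  | inc (r : ℕ)
  | dec (r : ℕ)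
  | seq (p q : Cm)
  /-- while counter `r` is nonzero do `p` -/
  | loop (r : ℕ) (p : Cm)

namespace Cm

open Function (update)

/-- `Run p s T s'`: from `s` the program `p` terminates in `s'` after `T` iterations of loops. -/
inductive Run : Cm → (ℕ → ℕ) → ℕ → (ℕ → ℕ) → Prop
  | skip (s) : Run .skip s 0 s
  | inc (r s) : Run (.inc r) s 0 (update s r (s r + 1))
  | dec (r s) : Run (.dec r) s 0 (update s r (s r - 1))
  | seq {p q s S s₁ T s₂} : Run p s S s₁ → Run q s₁ T s₂ → Run (.seq p q) s (S + T) s₂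
  | loop_zero {r p s} : s r = 0 → Run (.loop r p) s 0 s
  | loop_succ {r p s S s₁ T s₂} : s r ≠ 0 → Run p s S s₁ → Run (.loop r p) s₁ T s₂ →
      Run (.loop r p) s (S + T + 1) s₂

theorem Run.congr {p : Cm} {s s' t : ℕ → ℕ} {S T : ℕ} (h : Run p s S s') (hT : S = T)
    (ht : s' = t) : Run p s T t := hT ▸ ht ▸ h

/-- Set the counter `a` to zero. -/
def zero (a : ℕ) : Cm := .loop a (.dec a)

theorem run_zero (a : ℕ) (s : ℕ → ℕ) : Run (zero a) s (s a) (update s a 0) := by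
  generalize hc : s a = c
  induction c generalizing s with
  | zero => exact (Run.loop_zero hc).congr rfl (by rw [← hc, Function.update_eq_self])
  | succ c ih =>
    refine (Run.loop_succ (by omega) (Run.dec a s) (ih _ (by simp [hc]))).congr (by omega) ?_
    simp

/-- Add the counter `a` to the counter `b` and set `a` to zero. -/
def move (a b : ℕ) : Cm := .loop a (.seq (.dec a) (.inc b))

theorem run_move {a b : ℕ} (hab : a ≠ b) (s : ℕ → ℕ) :
    Run (move a b) s (s a) (update (update s b (s b + s a)) a 0) := by
  generalize hc : s a = c
  induction c generalizing s with
  | zero =>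
    refine (Run.loop_zero hc).congr rfl ?_
    ext1 j
    simp only [Function.update_apply]
    split_ifs <;> simp_all
  | succ c ih =>
    refine (Run.loop_succ (by omega) ((Run.dec a s).seq (Run.inc b _)) (ih _ ?_)).congr
      (by omega) ?_
    · simp [Function.update_of_ne hab, hc]
    · ext1 j
      simp only [Function.update_apply]
      split_ifs <;> simp_all; omega

/-- Add the counter `a` to the counters `b` and `c` and set `a` to zero. -/
def moveTwo (a b c : ℕ) : Cm := .loop a (.seq (.dec a) (.seq (.inc b) (.inc c)))

theorem run_moveTwo {a b c : ℕ} (hab : a ≠ b) (hac : a ≠ c) (hbc : b ≠ c) (s : ℕ → ℕ) :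
    Run (moveTwo a b c) s (s a)
      (update (update (update s c (s c + s a)) b (s b + s a)) a 0) := by
  generalize hn : s a = n
  induction n generalizing s with
  | zero =>
    refine (Run.loop_zero hn).congr rfl ?_
    ext1 j
    simp only [Function.update_apply]
    split_ifs <;> simp_all
  | succ n ih =>
    refine (Run.loop_succ (by omega) ((Run.dec a s).seq ((Run.inc b _).seq (Run.inc c _)))
      (ih _ ?_)).congr (by omega) ?_
    · simp [Function.update_of_ne hab, Function.update_of_ne hac, hn]
    · ext1 j
      simp only [Function.update_apply]
      split_ifs <;> simp_all <;> omega

/-- Add the counter `a` to the counter `b`, using the counter `c`. -/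
def copy (a b c : ℕ) : Cm := .seq (move a c) (moveTwo c a b)

theorem run_copy {a b c : ℕ} (hab : a ≠ b) (hac : a ≠ c) (hbc : b ≠ c) {s : ℕ → ℕ}
    (hc : s c = 0) : Run (copy a b c) s (2 * s a) (update s b (s b + s a)) := by
  refine ((run_move hac s).seq (run_moveTwo hac.symm hbc.symm hab _)).congr ?_ ?_
  · simp [Function.update_of_ne hac.symm, hc]; omega
  · ext1 j
    simp only [Function.update_apply]
    split_ifs <;> simp_all

/-! ## Primitive recursive functions -/

/-- `f` is computed by counter programs, with arguments and output in arbitrary counters, with at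
most `t` iterations of loops. -/
def Computes {n : ℕ} (f t : List.Vector ℕ n → ℕ) : Prop :=
  ∀ (args : Fin n → ℕ) (out base : ℕ), (∀ i, args i < base) → out < base →
    (∀ i, args i ≠ out) → ∃ p : Cm, ∀ s v, (∀ i, s (args i) = v.get i) → s out = 0 →
      (∀ r ≥ base, s r = 0) → ∃ T ≤ t v, Run p s T (update s out (f v))

theorem computes_succ : Computes (n := 1) (fun v => v.head.succ) (fun v => 2 * v.head) := by
  intro args out base ha ho hne
  have h0 := ha 0
  refine ⟨.seq (copy (args 0) out base) (.inc out), fun s v hv hs hz => ⟨_, ?_,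
    (Run.seq (run_copy (hne 0) (by omega) (by omega) (hz _ le_rfl)) (Run.inc out _)).congr
      rfl ?_⟩⟩
  · simp [hv]
  · simp [hs, hv]

theorem computes_get {n : ℕ} (i : Fin n) : Computes (fun v => v.get i) (fun v => 2 * v.get i) := by
  intro args out base ha ho hne
  have h0 := ha i
  refine ⟨copy (args i) out base, fun s v hv hs hz => ⟨_, ?_,
    (run_copy (hne i) (by omega) (by omega) (hz _ le_rfl)).congr rfl ?_⟩⟩
  · simp [hv]
  · simp [hs, hv]

/-- The results fill the block of counters from `base` to `base + m - 1`. A program as in `Computes`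
changes nothing but its output counter, so the scratch counters from `base + m` on are zero again
before every call. -/
theorem exists_run_list {m n : ℕ} {g t : Fin m → List.Vector ℕ n → ℕ}
    (hg : ∀ i, Computes (g i) (t i)) (args : Fin n → ℕ) (base : ℕ) (ha : ∀ i, args i < base)
    (l : List (Fin m)) (hl : l.Nodup) :
    ∃ p : Cm, ∀ s v, (∀ i, s (args i) = v.get i) → (∀ r ≥ base, s r = 0) →
      ∃ T ≤ (l.map fun i => t i v).sum, ∃ s', Run p s T s' ∧ (∀ i ∈ l, s' (base + i) = g i v) ∧
        ∀ r, (∀ i ∈ l, r ≠ base + i) → s' r = s r := by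
  induction l with
  | nil => exact ⟨.skip, fun s v _ _ => ⟨0, by simp, s, Run.skip s, by simp, by simp⟩⟩
  | cons i l ih =>
    obtain ⟨hil, hl⟩ := List.nodup_cons.1 hl
    obtain ⟨p, hp⟩ := ih hl
    obtain ⟨q, hq⟩ := hg i args (base + i) (base + m) (fun j => by have := ha j; omega) (by omega)
      (fun j => by have := ha j; omega)
    refine ⟨.seq p q, fun s v hv hz => ?_⟩
    obtain ⟨S, hS, s₁, hr, hin, hout⟩ := hp s v hv hz
    obtain ⟨T, hT, hr'⟩ := hq s₁ v
      (fun j => by rw [hout _ (fun i _ => by have := ha j; omega), hv])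
      (by
        rw [hout _ (fun j hj e => hil ?_), hz _ (by omega)]
        rwa [show i = j from Fin.ext (by omega)])
      (fun r h => by rw [hout _ (fun i _ => by omega), hz _ (by omega)])
    refine ⟨S + T, ?_, _, hr.seq hr', ?_, ?_⟩
    · simp; omega
    · intro j hj
      rcases List.mem_cons.1 hj with rfl | hj
      · simp
      · rw [Function.update_of_ne, hin j hj]
        intro e
        exact hil ((show i = j from Fin.ext (by omega)) ▸ hj)
    · intro r h
      rw [Function.update_of_ne (h i (by simp)), hout _ fun j hj => h j (by simp [hj])]

theorem exists_run_zero {m : ℕ} (base : ℕ) (l : List (Fin m)) (hl : l.Nodup) :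
    ∃ p : Cm, ∀ s, ∃ s', Run p s (l.map fun i : Fin m => s (base + i)).sum s' ∧
      (∀ i ∈ l, s' (base + i) = 0) ∧ ∀ r, (∀ i ∈ l, r ≠ base + i) → s' r = s r := by
  induction l with
  | nil => exact ⟨.skip, fun s => ⟨s, Run.skip s, by simp, by simp⟩⟩
  | cons i l ih =>
    obtain ⟨hil, hl⟩ := List.nodup_cons.1 hl
    obtain ⟨p, hp⟩ := ih hl
    refine ⟨.seq p (zero (base + i)), fun s => ?_⟩
    obtain ⟨s₁, hr, hin, hout⟩ := hp s
    refine ⟨_, (hr.seq (run_zero (base + i) s₁)).congr ?_ rfl, ?_, ?_⟩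
    · rw [hout _ (fun j hj e => hil ?_)]
      · simp [add_comm]
      · rwa [show i = j from Fin.ext (by omega)]
    · intro j hj
      rw [Function.update_apply]
      split_ifs with h
      · rfl
      · refine hin j ((List.mem_cons.1 hj).resolve_left ?_)
        rintro rfl
        exact h rfl
    · intro r h
      rw [Function.update_of_ne (h i (by simp)), hout _ fun j hj => h j (by simp [hj])]

/-- The time is that of the inner functions, that of the outer one, and one iteration for each unit
of the intermediate values that are erased at the end. -/
theorem Computes.comp {m n : ℕ} {f tf : List.Vector ℕ m → ℕ} {g t : Fin m → List.Vector ℕ n → ℕ}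
    (hf : Computes f tf) (hg : ∀ i, Computes (g i) (t i)) :
    Computes (fun v => f (List.Vector.ofFn fun i => g i v)) (fun v =>
      ∑ i, t i v + tf (List.Vector.ofFn fun i => g i v) + ∑ i, g i v) := by
  intro args out base ha ho hne
  obtain ⟨p, hp⟩ := exists_run_list hg args base ha _ (List.nodup_finRange m)
  obtain ⟨q, hq⟩ := hf (fun i => base + i) out (base + m) (fun i => by omega) (by omega)
    (fun i => by omega)
  obtain ⟨c, hc⟩ := exists_run_zero base _ (List.nodup_finRange m)
  refine ⟨.seq p (.seq q c), fun s v hv hs hz => ?_⟩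
  obtain ⟨S, hS, s₁, hr, hin, hout⟩ := hp s v hv hz
  obtain ⟨T, hT, hr'⟩ := hq s₁ (List.Vector.ofFn fun i => g i v)
    (fun i => by rw [hin i (List.mem_finRange i), List.Vector.get_ofFn])
    (by rw [hout _ (fun i _ => by omega), hs])
    (fun r h => by rw [hout _ (fun i _ => by omega), hz _ (by omega)])
  obtain ⟨s₂, hr'', hin', hout'⟩ := hc (update s₁ out (f (List.Vector.ofFn fun i => g i v)))
  refine ⟨_, ?_, (hr.seq (hr'.seq hr'')).congr rfl ?_⟩
  · have : ((List.finRange m).map fun i : Fin m => update s₁ out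
        (f (List.Vector.ofFn fun i => g i v)) (base + i)).sum = ∑ i, g i v := by
      rw [Fin.sum_univ_def]
      congr 1
      refine List.map_congr_left fun i hi => ?_
      rw [Function.update_of_ne (by omega), hin i hi]
    rw [this]
    rw [← Fin.sum_univ_def] at hS
    beta_reduce
    omega
  · ext1 r
    by_cases h : ∃ i : Fin m, r = base + i
    · obtain ⟨i, rfl⟩ := h
      rw [hin' i (List.mem_finRange i), Function.update_of_ne (by omega), hz _ (by omega)]
    · push Not at h
      rw [hout' r fun i _ => h i, Function.update_apply, Function.update_apply,
        hout r fun i _ => h i]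

/-- Counter `base` holds the rounds still to do, `base + 1` the recursion index, `base + 2` the
current value and `base + 3` the next one; scratch space starts at `base + 4`. The summand `3 *
v.head` pays for copying the recursion argument and for erasing the index; each round pays for `g`,
for erasing the old value and for moving the new one. -/
theorem Computes.prec {n : ℕ} {f tf : List.Vector ℕ n → ℕ} {g tg : List.Vector ℕ (n + 2) → ℕ}
    (hf : Computes f tf) (hg : Computes g tg) (R : List.Vector ℕ n → ℕ → ℕ)
    (hR₀ : ∀ v, R v 0 = f v) (hR : ∀ v k, R v (k + 1) = g (k ::ᵥ R v k ::ᵥ v)) :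
    Computes (fun v : List.Vector ℕ (n + 1) => R v.tail v.head) (fun v => 3 * v.head + tf v.tail +
      ∑ i ∈ Finset.range v.head, (tg (i ::ᵥ R v.tail i ::ᵥ v.tail) + R v.tail i +
        R v.tail (i + 1) + 1) + R v.tail v.head) := by
  intro args out base ha ho hne
  obtain ⟨pf, hpf⟩ := hf (fun i => args i.succ) (base + 2) (base + 4)
    (fun i => by have := ha i.succ; omega) (by omega) (fun i => by have := ha i.succ; omega)
  obtain ⟨pg, hpg⟩ := hg (Fin.cons (base + 1) (Fin.cons (base + 2) fun i => args i.succ)) (base + 3)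
    (base + 4)
    (by
      refine Fin.cases (by simp) (Fin.cases (by simp) fun i => ?_)
      have := ha i.succ
      simp; omega)
    (by omega)
    (by
      refine Fin.cases (by simp) (Fin.cases (by simp) fun i => ?_)
      have := ha i.succ
      simp; omega)
  set body : Cm := .seq (.dec base) (.seq pg (.seq (zero (base + 2))
    (.seq (move (base + 3) (base + 2)) (.inc (base + 1))))) with hbody
  -- Here `j` rounds are done and `c` remain; the induction on `c` needs `j` to vary.
  have loop : ∀ (c j : ℕ) (s : ℕ → ℕ) (v : List.Vector ℕ n),
      (∀ i : Fin n, s (args i.succ) = v.get i) → s base = c → s (base + 1) = j →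
      s (base + 2) = R v j → (∀ r ≥ base + 3, s r = 0) →
      ∃ T ≤ ∑ i ∈ Finset.range c, (tg ((j + i) ::ᵥ R v (j + i) ::ᵥ v) + R v (j + i) +
        R v (j + i + 1) + 1), Run (.loop base body) s T
          (update (update (update s base 0) (base + 1) (j + c)) (base + 2) (R v (j + c))) := by
    intro c
    induction c with
    | zero =>
      intro j s v hv h0 h1 h2 hz
      refine ⟨0, by simp, (Run.loop_zero h0).congr rfl ?_⟩
      ext1 r
      simp only [Function.update_apply]
      split_ifs <;> simp_all
    | succ c ih =>
      intro j s v hv h0 h1 h2 hz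
      obtain ⟨S, hS, hr⟩ := hpg (update s base (s base - 1)) (j ::ᵥ R v j ::ᵥ v)
        (by
          refine Fin.cases (by simp [h1]) (Fin.cases ?_ fun i => ?_)
          · rw [Fin.cons_succ, Fin.cons_zero, Function.update_of_ne (by omega), h2]
            rfl
          have := ha i.succ
          simp [Function.update_of_ne this.ne, hv])
        (by simp [hz])
        (fun r h => by rw [Function.update_of_ne (by omega), hz _ (by omega)])
      obtain ⟨s₁, hb, e0, e1, e2, er⟩ : ∃ s₁, Run body s (S + (R v j + R v (j + 1))) s₁ ∧
          s₁ base = c ∧ s₁ (base + 1) = j + 1 ∧ s₁ (base + 2) = R v (j + 1) ∧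
          ∀ r, r ≠ base → r ≠ base + 1 → r ≠ base + 2 → s₁ r = s r := by
        refine ⟨_, ((Run.dec base s).seq (hr.seq ((run_zero (base + 2) _).seq
          ((run_move (show base + 3 ≠ base + 2 by omega) _).seq (Run.inc (base + 1) _))))).congr
          ?_ rfl, ?_, ?_, ?_, fun r k0 k1 k2 => ?_⟩
        · simp [h2, hR]
        · simp [h0]
        · simp [h1]
        · simp [hR]
        · rw [Function.update_of_ne k1, Function.update_apply]
          split_ifs with k3
          · rw [hz r (by omega)]
          · rw [Function.update_of_ne k2, Function.update_of_ne k2, Function.update_of_ne k3,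
              Function.update_of_ne k0]
      obtain ⟨T, hT, hr'⟩ := ih (j + 1) s₁ v
        (fun i => by
          have := ha i.succ
          rw [er _ (by omega) (by omega) (by omega), hv])
        e0 e1 e2
        (fun r h => by rw [er _ (by omega) (by omega) (by omega), hz r h])
      refine ⟨_, ?_, (Run.loop_succ (by omega) hb hr').congr rfl ?_⟩
      · rw [Finset.sum_range_succ']
        simp only [show ∀ i, j + 1 + i = j + (i + 1) by intro i; omega] at hT
        simp only [add_zero]
        omega
      · ext1 r
        simp only [Function.update_apply, show j + 1 + c = j + (c + 1) by omega]
        split_ifs with k2 k1 k0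
        · rfl
        · rfl
        · rfl
        · exact er r k0 k1 k2
  refine ⟨.seq (copy (args 0) base (base + 1)) (.seq pf (.seq (.loop base body)
    (.seq (move (base + 2) out) (zero (base + 1))))), fun s v hv hs hz => ?_⟩
  have h0 := ha 0
  have hcopy := run_copy (s := s) (show args 0 ≠ base by omega)
    (show args 0 ≠ base + 1 by omega) (show base ≠ base + 1 by omega) (hz _ (by omega))
  obtain ⟨S, hS, hr⟩ := hpf (update s base (s base + s (args 0))) v.tail
    (fun i => by
      have := ha i.succ
      rw [Function.update_of_ne (by omega), hv, List.Vector.get_tail_succ])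
    (by rw [Function.update_of_ne (by omega), hz _ (by omega)])
    (fun r h => by rw [Function.update_of_ne (by omega), hz _ (by omega)])
  obtain ⟨T, hT, hl⟩ := loop v.head 0
    (update (update s base (s base + s (args 0))) (base + 2) (f v.tail)) v.tail
    (fun i => by
      have := ha i.succ
      rw [Function.update_of_ne (by omega), Function.update_of_ne (by omega), hv,
        List.Vector.get_tail_succ])
    (by
      rw [Function.update_of_ne (by omega), Function.update_self, hz _ le_rfl, hv,
        List.Vector.get_zero, zero_add])
    (by rw [Function.update_of_ne (by omega), Function.update_of_ne (by omega), hz _ (by omega)])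
    (by rw [Function.update_self, hR₀])
    (fun r h => by
      rw [Function.update_of_ne (by omega), Function.update_of_ne (by omega), hz _ (by omega)])
  refine ⟨_, ?_, (hcopy.seq (hr.seq (hl.seq ((run_move (show base + 2 ≠ out by omega) _).seq
    (run_zero (base + 1) _))))).congr rfl ?_⟩
  · have : base + 1 ≠ out := by omega
    simp only [zero_add] at hT
    simp [Function.update_apply, this, hv]
    omega
  · have h1 : out ≠ base := by omega
    have h2 : out ≠ base + 1 := by omega
    have h3 : out ≠ base + 2 := by omega
    ext1 r
    simp only [Function.update_apply, zero_add]
    split_ifs <;> first | omega | exact (hz _ (by omega)).symm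

theorem primrec_sum {α ι : Type*} [Primcodable α] {t : ι → α → ℕ} (ht : ∀ i, Primrec (t i))
    (s : Finset ι) : Primrec fun a => ∑ i ∈ s, t i a := by
  classical
  induction s using Finset.induction_on with
  | empty => exact (Primrec.const 0).of_eq fun a => by simp
  | insert i s his ih => exact (Primrec.nat_add.comp (ht i) ih).of_eq fun a => by simp [his]

theorem primrec_sum_range {α : Type*} [Primcodable α] {h : α → ℕ → ℕ} {c : α → ℕ}
    (hh : Primrec₂ h) (hc : Primrec c) : Primrec fun a => ∑ i ∈ Finset.range (c a), h a i := by
  refine (Primrec.nat_rec' (g := fun _ => 0) (h := fun a (p : ℕ × ℕ) => p.2 + h a p.1) hc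
    (Primrec.const 0) ?_).of_eq fun a => ?_
  · exact (Primrec.nat_add.comp (Primrec.snd.comp Primrec.snd)
      (hh.comp Primrec.fst (Primrec.fst.comp Primrec.snd)))
  · generalize c a = n
    induction n with
    | zero => rfl
    | succ n ih => rw [Finset.sum_range_succ, ← ih]

/-- Every primitive recursive function is computed by counter programs in primitive recursive
time. -/
theorem exists_computes {n : ℕ} {f : List.Vector ℕ n → ℕ} (hf : Nat.Primrec' f) :
    ∃ t : List.Vector ℕ n → ℕ, Primrec t ∧ Computes f t := by
  induction hf with
  | zero =>
    refine ⟨fun _ => 0, Primrec.const 0, fun args out base _ _ _ => ⟨.skip, fun s v _ hs _ =>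
      ⟨0, le_rfl, (Run.skip s).congr rfl ?_⟩⟩⟩
    exact (Function.update_eq_self_iff.2 hs.symm).symm
  | succ => exact ⟨_, Primrec.nat_mul.comp (Primrec.const 2) Primrec.vector_head, computes_succ⟩
  | get i =>
    exact ⟨_, Primrec.nat_mul.comp (Primrec.const 2)
      (Primrec.vector_get.comp Primrec.id (Primrec.const i)), computes_get i⟩
  | comp g hf hg ihf ihg =>
    obtain ⟨tf, htf, hcf⟩ := ihf
    choose t ht hc using ihg
    refine ⟨_, ?_, hcf.comp hc⟩
    exact Primrec.nat_add.comp (Primrec.nat_add.comp (primrec_sum ht _)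
      (htf.comp (Primrec.vector_ofFn fun i => (hg i).to_prim)))
      (primrec_sum (fun i => (hg i).to_prim) _)
  | @prec n f g hf hg ihf ihg =>
    obtain ⟨tf, htf, hcf⟩ := ihf
    obtain ⟨tg, htg, hcg⟩ := ihg
    set R : List.Vector ℕ n → ℕ → ℕ := fun v k =>
      k.rec (f v) fun y IH => g (y ::ᵥ IH ::ᵥ v) with hR
    have pR : Primrec₂ R :=
      Primrec.nat_rec hf.to_prim (hg.to_prim.comp (Primrec.vector_cons.comp
        (Primrec.fst.comp Primrec.snd) (Primrec.vector_cons.comp (Primrec.snd.comp Primrec.snd)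
          Primrec.fst))).to₂
    refine ⟨_, ?_, (hcf.prec hcg R (fun _ => rfl) fun _ _ => rfl)⟩
    have pt : Primrec fun p : List.Vector ℕ (n + 1) × ℕ => p.1.tail :=
      Primrec.vector_tail.comp Primrec.fst
    have pRi : Primrec fun p : List.Vector ℕ (n + 1) × ℕ => R p.1.tail p.2 :=
      pR.comp pt Primrec.snd
    refine Primrec.nat_add.comp (Primrec.nat_add.comp (Primrec.nat_add.comp
      (Primrec.nat_mul.comp (Primrec.const 3) Primrec.vector_head)
      (htf.comp Primrec.vector_tail)) (primrec_sum_range ?_ Primrec.vector_head))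
      (pR.comp Primrec.vector_tail Primrec.vector_head)
    refine Primrec.nat_add.comp (Primrec.nat_add.comp (Primrec.nat_add.comp (htg.comp
      (Primrec.vector_cons.comp Primrec.snd (Primrec.vector_cons.comp pRi pt))) pRi)
      (pR.comp pt (Primrec.succ.comp Primrec.snd))) (Primrec.const 1)

theorem exists_run_of_primrec {f : ℕ → ℕ} (hf : Primrec f) :
    ∃ (t : ℕ → ℕ) (p : Cm), Primrec t ∧ ∀ s : ℕ → ℕ, (∀ r ≠ 0, s r = 0) →
      ∃ T ≤ t (s 0), Run p s T (update s 1 (f (s 0))) := by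
  obtain ⟨t, ht, hc⟩ := exists_computes (Nat.Primrec'.prim_iff₁.2 hf)
  obtain ⟨p, hp⟩ := hc (fun _ => 0) 1 2 (by simp) (by simp) (by simp)
  refine ⟨fun a => t (a ::ᵥ List.Vector.nil), p,
    ht.comp (Primrec.vector_cons.comp Primrec.id (Primrec.const _)), fun s hs => ?_⟩
  exact hp s (s 0 ::ᵥ List.Vector.nil) (fun i => by rw [Fin.eq_zero i]; rfl) (hs _ (by simp))
    fun r hr => hs _ (by omega)

end Cm

end QPC

namespace QPC

namespace Cm

open Function (update)

/-! ## Clocked execution of counter programs -/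

/-- Push a flag onto register `9` if counter `r` and the clock (register `8`) are nonzero. -/
def setFlag (r : ℕ) : Prog :=
  .ifTrue (r + 10) (.ifTrue 8 (.push 9 true) .skip) .skip

/-- Counter `r` is kept in unary in register `r + 10`; every iteration of a loop decreases the clock
in register `8`, and all loops are left when the clock has run down. -/
def toProg : Cm → Prog
  | .skip => .skip
  | .inc r => .push (r + 10) true
  | .dec r => .pop (r + 10)
  | .seq p q => .seq p.toProg q.toProg
  -- A while loop tests a single register, so the conjunction of "counter nonzero" and "clock
  -- nonzero" is first condensed into the flag.
  | .loop r p => .seq (setFlag r) (.whileNonempty 9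
      (.seq (.pop 9) (.seq (.pop 8) (.seq p.toProg (setFlag r)))))

/-- The factor in the bound on the running time of `toProg`. -/
def cost : Cm → ℕ
  | .skip => 1
  | .inc _ => 1
  | .dec _ => 1
  | .seq p q => p.cost + q.cost + 1
  | .loop _ p => p.cost + 10

/-- All counters that a program uses are below this bound. -/
def bound : Cm → ℕ
  | .skip => 0
  | .inc r => r + 1
  | .dec r => r + 1
  | .seq p q => max p.bound q.bound
  | .loop r p => max (r + 1) p.bound

/-- Registers with clock `n`, no flag, counters `s`, and `σ` on the registers below `8`. -/
def regs (σ : ℕ → List Bool) (n : ℕ) (s : ℕ → ℕ) : ℕ → List Bool := fun j =>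
  if j < 8 then σ j else if j = 8 then List.replicate n true else if j = 9 then []
  else List.replicate (s (j - 10)) true

variable (σ : ℕ → List Bool) (n : ℕ) (s : ℕ → ℕ)

theorem regs_eight : regs σ n s 8 = List.replicate n true := by simp [regs]

theorem regs_nine : regs σ n s 9 = [] := by simp [regs]

theorem regs_counter (r : ℕ) : regs σ n s (r + 10) = List.replicate (s r) true := by
  simp [regs, show ¬ r + 10 < 8 by omega, show ¬ r + 10 = 8 by omega]

theorem regs_lt {j : ℕ} (hj : j < 8) : regs σ n s j = σ j := by simp [regs, hj]

theorem update_regs_counter (r c : ℕ) :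
    update (regs σ n s) (r + 10) (List.replicate c true) = regs σ n (update s r c) := by
  ext1 j
  simp only [regs, Function.update_apply]
  split_ifs <;> first | omega | rfl

theorem update_regs_eight (m : ℕ) :
    update (regs σ n s) 8 (List.replicate m true) = regs σ m s := by
  ext1 j
  simp only [regs, Function.update_apply]
  split_ifs <;> first | omega | rfl

theorem update_regs_lt {j : ℕ} (hj : j < 8) (l : List Bool) :
    update (regs σ n s) j l = regs (update σ j l) n s := by
  ext1 i
  simp only [regs, Function.update_apply]
  split_ifs <;> first | omega | rfl

open Classical in
/-- The registers after `setFlag r`. -/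
noncomputable def flagged (r : ℕ) : ℕ → List Bool :=
  if s r = 0 ∨ n = 0 then regs σ n s else update (regs σ n s) 9 [true]

theorem head?_replicate_eq_iff (c : ℕ) :
    (List.replicate c true).head? = some true ↔ c ≠ 0 := by
  cases c <;> simp [List.replicate_succ]

theorem exec_setFlag (r : ℕ) : Exec (setFlag r) (regs σ n s) (flagged σ n s r) 3 := by
  unfold flagged
  by_cases hs : s r = 0
  · rw [if_pos (Or.inl hs)]
    refine (Exec.ifTrue_neg ?_ Exec.skip).mono (by omega)
    rw [regs_counter, Ne, head?_replicate_eq_iff]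
    simp [hs]
  refine Exec.ifTrue_pos ?_ ?_ (a := 2)
  · rw [regs_counter, head?_replicate_eq_iff]
    exact hs
  by_cases hn : n = 0
  · rw [if_pos (Or.inr hn)]
    refine Exec.ifTrue_neg ?_ Exec.skip
    rw [regs_eight, Ne, head?_replicate_eq_iff]
    simp [hn]
  · rw [if_neg (by tauto)]
    refine Exec.ifTrue_pos ?_ ((Exec.push 9 true).congr (by rw [regs_nine]) le_rfl)
    rw [regs_eight, head?_replicate_eq_iff]
    exact hn

/-- With an empty clock no loop body is entered, so the time does not depend on the counters. This
covers the code that follows the point where the clock has run down, where the counters no longer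
agree with any given `Run`. -/
theorem exec_toProg_zero (p : Cm) (σ : ℕ → List Bool) (s : ℕ → ℕ) :
    ∃ s', (∀ r ≥ p.bound, s' r = s r) ∧
      Exec p.toProg (regs σ 0 s) (regs σ 0 s') p.cost := by
  induction p generalizing s with
  | skip => exact ⟨s, fun _ _ => rfl, Exec.skip⟩
  | inc r =>
    refine ⟨update s r (s r + 1), fun j hj => Function.update_of_ne (by simp [bound] at hj; omega) ..,
      (Exec.push _ _).congr ?_ le_rfl⟩
    rw [← update_regs_counter, regs_counter, List.replicate_succ]
  | dec r =>
    refine ⟨update s r (s r - 1), fun j hj => Function.update_of_ne (by simp [bound] at hj; omega) ..,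
      (Exec.pop _).congr ?_ le_rfl⟩
    rw [← update_regs_counter, regs_counter, List.tail_replicate]
  | seq p q ihp ihq =>
    obtain ⟨s₁, h₁, e₁⟩ := ihp s
    obtain ⟨s₂, h₂, e₂⟩ := ihq s₁
    refine ⟨s₂, fun r hr => ?_, e₁.seq e₂⟩
    simp only [bound, ge_iff_le, sup_le_iff] at hr
    rw [h₂ r hr.2, h₁ r hr.1]
  | loop r p ih =>
    refine ⟨s, fun _ _ => rfl, ((exec_setFlag σ 0 s r).seq (Exec.while_nil ?_)).congr ?_ ?_⟩
    · simp [flagged, regs_nine]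
    · simp [flagged]
    · simp [cost]

/-- Execution with clock `n` of a program that needs `T` iterations: if the clock suffices, the
result is right, and otherwise the clock runs down. -/
theorem Run.exec {p : Cm} {s s' : ℕ → ℕ} {T : ℕ} (h : Run p s T s') (σ : ℕ → List Bool) (n : ℕ) :
    ∃ s'', (T ≤ n → s'' = s') ∧ (∀ r ≥ p.bound, s'' r = s r) ∧
      Exec p.toProg (regs σ n s) (regs σ (n - T) s'') (p.cost * (n - (n - T) + 1)) := by
  -- Subtraction is truncated: `n - (n - T)` is `min n T`, the number of ticks that are really used.
  induction p generalizing s T s' n with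
  | skip =>
    cases h
    exact ⟨s, fun _ => rfl, fun _ _ => rfl, Exec.skip.mono (by simp [cost])⟩
  | inc r =>
    cases h
    refine ⟨update s r (s r + 1), fun _ => rfl,
      fun j hj => Function.update_of_ne (by simp [bound] at hj; omega) ..,
      (Exec.push _ _).congr ?_ (by simp [cost])⟩
    rw [← update_regs_counter, regs_counter, List.replicate_succ]
    rfl
  | dec r =>
    cases h
    refine ⟨update s r (s r - 1), fun _ => rfl,
      fun j hj => Function.update_of_ne (by simp [bound] at hj; omega) ..,
      (Exec.pop _).congr ?_ (by simp [cost])⟩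
    rw [← update_regs_counter, regs_counter, List.tail_replicate]
    rfl
  | seq p q ihp ihq =>
    cases h with
    | @seq _ _ _ S s₁ T _ hp hq =>
    obtain ⟨t₁, e₁, b₁, x₁⟩ := ihp hp n
    by_cases hS : S ≤ n
    · obtain rfl := e₁ hS
      obtain ⟨t₂, e₂, b₂, x₂⟩ := ihq hq (n - S)
      refine ⟨t₂, fun h => e₂ (by omega), fun r hr => ?_, (x₁.seq x₂).congr ?_ ?_⟩
      · simp only [bound, ge_iff_le, sup_le_iff] at hr
        rw [b₂ r hr.2, b₁ r hr.1]
      · rw [Nat.sub_sub]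
      · rw [cost, Nat.sub_sub n S T]
        have h1 : n - (n - S) + 1 ≤ n - (n - (S + T)) + 1 := by omega
        have h2 : n - S - (n - (S + T)) + 1 ≤ n - (n - (S + T)) + 1 := by omega
        have := Nat.mul_le_mul_left p.cost h1
        have := Nat.mul_le_mul_left q.cost h2
        rw [Nat.add_mul, Nat.add_mul]
        omega
    · obtain ⟨t₂, b₂, x₂⟩ := exec_toProg_zero q σ t₁
      rw [show n - S = 0 by omega] at x₁
      refine ⟨t₂, fun h => by omega, fun r hr => ?_, (x₁.seq x₂).congr ?_ ?_⟩
      · simp only [bound, ge_iff_le, sup_le_iff] at hr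
        rw [b₂ r hr.2, b₁ r hr.1]
      · rw [show n - (S + T) = 0 by omega]
      · rw [cost, show n - (S + T) = 0 by omega, Nat.add_mul, Nat.add_mul]
        have := Nat.le_mul_of_pos_right q.cost (Nat.succ_pos (n - 0))
        simp only [Nat.succ_eq_add_one] at this
        omega
  | loop r p ih =>
    suffices H : ∃ s'', (T ≤ n → s'' = s') ∧ (∀ j ≥ (Cm.loop r p).bound, s'' j = s j) ∧
        Exec (.whileNonempty 9 (.seq (.pop 9) (.seq (.pop 8) (.seq p.toProg (setFlag r)))))
          (flagged σ n s r) (regs σ (n - T) s'') ((p.cost + 10) * (n - (n - T)) + 1) by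
      obtain ⟨s'', e, b, x⟩ := H
      refine ⟨s'', e, b, ((exec_setFlag σ n s r).seq x).mono ?_⟩
      rw [cost, Nat.mul_add_one]
      omega
    -- The outer induction on the program handles the loop body; an inner one on the derivation of
    -- the run handles the iterations.
    generalize hq : Cm.loop r p = q at h
    induction h generalizing n with
    | skip | inc | dec | seq => cases hq
    | @loop_zero r' p' s h0 =>
      cases hq
      refine ⟨s, fun _ => rfl, fun _ _ => rfl, ?_⟩
      simp only [flagged, h0, true_or, if_true]
      exact (Exec.while_nil (regs_nine ..)).mono (by omega)
    | @loop_succ r' p' s S s₁ T s₂ h0 hp hl _ ihl =>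
      cases hq
      rcases n with - | n
      · refine ⟨s, fun h => by omega, fun _ _ => rfl, ?_⟩
        simp only [flagged, or_true, if_true]
        rw [Nat.zero_sub]
        exact (Exec.while_nil (regs_nine ..)).mono (by omega)
      have hfl : flagged σ (n + 1) s r = update (regs σ (n + 1) s) 9 [true] := by
        simp [flagged, h0]
      obtain ⟨t₁, e₁, b₁, x₁⟩ := ih hp n
      have body : Exec (.seq (.pop 9) (.seq (.pop 8) (.seq p.toProg (setFlag r))))
          (flagged σ (n + 1) s r) (flagged σ (n - S) t₁ r)
          (p.cost * (n - (n - S) + 1) + 8) := by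
        have h9 : Exec (.pop 9) (flagged σ (n + 1) s r) (regs σ (n + 1) s) 1 :=
          (Exec.pop 9).congr (by
            rw [hfl, Function.update_self, Function.update_idem, List.tail_cons, ← regs_nine σ (n + 1) s,
              Function.update_eq_self]) le_rfl
        have h8 : Exec (.pop 8) (regs σ (n + 1) s) (regs σ n s) 1 :=
          (Exec.pop 8).congr (by
            rw [regs_eight, List.tail_replicate, update_regs_eight, Nat.add_sub_cancel]) le_rfl
        exact (h9.seq (h8.seq (x₁.seq (exec_setFlag σ (n - S) t₁ r)))).mono (by omega)
      have hne : flagged σ (n + 1) s r 9 ≠ [] := by simp [hfl]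
      by_cases hS : S ≤ n
      · obtain rfl := e₁ hS
        obtain ⟨t₂, e₂, b₂, x₂⟩ := ihl (n - S) rfl
        refine ⟨t₂, fun h => e₂ (by omega), fun j hj => ?_,
          (Exec.while_cons hne body x₂).congr ?_ ?_⟩
        · rw [b₂ j hj, b₁ j]
          simp only [bound, ge_iff_le, sup_le_iff] at hj
          exact hj.2
        · rw [show n - S - T = n + 1 - (S + T + 1) by omega]
        · have h1 : n + 1 - (n + 1 - (S + T + 1)) = n - (n - S) + 1 + (n - S - (n - S - T)) := by
            omega
          rw [h1, Nat.mul_add (p.cost + 10), Nat.add_mul p.cost, Nat.add_mul p.cost]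
          omega
      -- The clock runs down inside the body, so the flag is not set again and the loop is left.
      · have hn : n - S = 0 := by omega
        have hfl' : flagged σ (n - S) t₁ r = regs σ 0 t₁ := by simp [flagged, hn]
        rw [hfl'] at body
        refine ⟨t₁, fun h => by omega, fun j hj => b₁ j ?_,
          (Exec.while_cons hne body (Exec.while_nil (regs_nine ..))).congr ?_ ?_⟩
        · simp only [bound, ge_iff_le, sup_le_iff] at hj
          exact hj.2
        · rw [show n + 1 - (S + T + 1) = 0 by omega]
        · rw [show n + 1 - (S + T + 1) = 0 by omega, hn, Nat.add_mul p.cost]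
          simp only [Nat.sub_zero]
          omega

end Cm

end QPC

namespace QPC

open Function (update)

/-! ## Slowly growing functions -/

open Nat.Partrec in
/-- For a computable `f` there is a primitive recursive `K`, unbounded in an effective way, with
`f (K s) ≤ s` whenever `K s` is nonzero. -/
theorem exists_slow {f : ℕ → ℕ} (hf : Computable f) :
    ∃ K M : ℕ → ℕ, Primrec K ∧ Computable M ∧ (∀ s, K s ≤ s) ∧ (∀ s, K s ≠ 0 → f (K s) ≤ s) ∧
      ∀ k s, M k ≤ s → k ≤ K s := by
  obtain ⟨c, hc⟩ := Code.exists_code.1 (Partrec.nat_iff.1 hf)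
  have hev : ∀ k v, v ∈ Code.eval c k ↔ v = f k := fun k v => by rw [hc]; simp
  -- The test asks whether evaluation with fuel `s` finds `f k` and the value is at most `s`. It is
  -- primitive recursive, monotone in `s`, and true for all large `s`. The witness `K s` is the
  -- greatest `k ≤ s` that passes, and `M k` is the least `s ≥ k` for which `k` passes, found by
  -- unbounded search.
  obtain ⟨test, ptest, htest⟩ : ∃ test : ℕ → ℕ → Bool, Primrec₂ test ∧
      ∀ s k, test s k = true ↔ ∃ v ≤ s, v ∈ Code.evaln s c k := by
    refine ⟨fun s k => (Code.evaln s c k).casesOn false fun v => decide (v ≤ s), ?_, fun s k => ?_⟩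
    · refine Primrec.option_casesOn (Code.primrec_evaln.comp (Primrec.pair (Primrec.pair Primrec.fst
        (Primrec.const c)) Primrec.snd)) (Primrec.const false) ?_
      exact (Primrec.nat_le.decide.comp Primrec.snd (Primrec.fst.comp Primrec.fst)).to₂
    · cases h : Code.evaln s c k <;> simp [h]
  have : DecidableRel fun s k => test s k = true := fun s k =>
    inferInstanceAs (Decidable (test s k = true))
  have prel : PrimrecRel fun s k => test s k = true :=
    ⟨fun a => inferInstanceAs (Decidable (test a.1 a.2 = true)),
      Primrec.of_eq ptest fun a => by simp⟩
  have mono : ∀ {s s' k}, s ≤ s' → test s k = true → test s' k = true := fun {s s' k} h ht => by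
    rw [htest] at ht ⊢
    obtain ⟨v, hv, hm⟩ := ht
    exact ⟨v, hv.trans h, Code.evaln_mono h hm⟩
  have total : ∀ k, ∃ s, (decide (k ≤ s) && test s k) = true := fun k => by
    obtain ⟨s, hs⟩ := Code.evaln_complete.1 ((hev k _).2 rfl)
    refine ⟨max s (max k (f k)), ?_⟩
    simp only [Bool.and_eq_true, decide_eq_true_eq]
    exact ⟨by omega, (htest _ _).2 ⟨f k, by omega, Code.evaln_mono (by omega) hs⟩⟩
  have prim : Primrec₂ fun k s => decide (k ≤ s) && test s k :=
    Primrec.and.comp Primrec.nat_le.decide (ptest.comp Primrec.snd Primrec.fst)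
  have least : ∀ k, ∃ s, (decide (k ≤ s) && test s k) = true ∧
      ∀ m < s, (decide (k ≤ m) && test m k) = false := fun k => by
    classical
    exact ⟨Nat.find (total k), Nat.find_spec (total k), fun m hm => by
      simpa using Nat.find_min (total k) hm⟩
  choose M hM hmin using least
  refine ⟨fun s => Nat.findGreatest (fun k => test s k = true) s, M,
    Primrec.nat_findGreatest (p := fun s k => test s k = true) Primrec.id prel, ?_, fun s =>
    Nat.findGreatest_le s, fun s hs => ?_, fun k s hks => ?_⟩
  · refine (Partrec.rfind prim.to_comp.partrec₂).of_eq_tot fun k => ?_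
    rw [Nat.mem_rfind]
    exact ⟨by simpa using hM k, fun {m} hm => by simpa using hmin k m hm⟩
  -- `Nat.findGreatest` also returns `0` if nothing passes the test, hence the restriction to
  -- nonzero values.
  · have := Nat.findGreatest_of_ne_zero (P := fun k => test s k = true) rfl hs
    obtain ⟨v, hv, hm⟩ := (htest _ _).1 this
    rwa [(hev _ _).1 (Code.evaln_sound hm)] at hv
  · have := hM k
    simp only [Bool.and_eq_true, decide_eq_true_eq] at this
    exact Nat.le_findGreatest (this.1.trans hks) (mono hks this.2)

theorem computable_sum_range {f : ℕ → ℕ} (hf : Computable f) :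
    Computable fun n => ∑ i ∈ Finset.range n, f i := by
  refine (Computable.nat_rec (f := fun n : ℕ => n) (g := fun _ => 0)
    (h := fun _ (p : ℕ × ℕ) => p.2 + f p.1) Computable.id (Computable.const 0) ?_).of_eq fun n => ?_
  · exact (Primrec.nat_add.to_comp.comp (Computable.snd.comp Computable.snd)
      (hf.comp (Computable.fst.comp Computable.snd))).to₂
  · induction n with
    | zero => rfl
    | succ n ih => rw [Finset.sum_range_succ, ← ih]

/-! ## Growth of the registers -/

/-- A step pushes at most one bit. This bounds the cost of erasing leftover registers and the size
of every unary number in an output. -/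
theorem length_reg_le {T : ℕ} {κ κ' : Config} (h : κ' ∈ steps T κ) (r : ℕ) :
    (κ'.reg r).length ≤ (κ.reg r).length + T := by
  induction T generalizing κ with
  | zero =>
    obtain rfl := List.mem_singleton.1 h
    rfl
  | succ T ih =>
    obtain ⟨κ₁, h₁, h⟩ := List.mem_flatMap.1 h
    refine (ih h).trans ?_
    suffices (κ₁.reg r).length ≤ (κ.reg r).length + 1 by omega
    obtain ⟨K, σ, ψ⟩ := κ
    have hu : ∀ r' b, (update σ r' (b :: σ r') r).length ≤ (σ r).length + 1 := fun r' b => by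
      rw [Function.update_apply]
      split_ifs with h
      · simp [h]
      · omega
    rcases K with _ | ⟨p, K⟩
    · simp only [step, List.mem_singleton] at h₁
      simp [h₁]
    · cases p <;> simp only [step] at h₁ <;> (try split_ifs at h₁) <;>
        simp only [List.mem_cons, List.not_mem_nil, or_false] at h₁
      case measure => rcases h₁ with rfl | rfl <;> exact hu _ _
      all_goals subst h₁
      case push => exact hu _ _
      case pop r' =>
        dsimp only
        rw [Function.update_apply]
        split_ifs with h
        · simp [h]; omega
        · omega
      all_goals simp

theorem Exec.length_le {p : Prog} {σ σ' : ℕ → List Bool} {B : ℕ} (h : Exec p σ σ' B) (r : ℕ) :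
    (σ' r).length ≤ (σ r).length + B := by
  obtain ⟨T, hT, h⟩ := h
  have := length_reg_le (T := T) (κ := ⟨[p], σ, 0⟩) (κ' := ⟨[], σ', 0⟩) (by simp [h]) r
  dsimp only at this
  omega

/-! ## Computing a slowly growing function -/

namespace Cm

/-- Evaluate the function computed by `p` at `0, 1, 2, …` as long as the clock in register `8`
allows it, keeping the last value in register `7`. -/
def slowLoop (p : Cm) : Prog :=
  .whileNonempty 8 (.seq (.pop 8) (.seq p.toProg
    (.ifTrue 8 (.seq (clear 7) (.seq (moveRev 11 7) (.push 10 true))) .skip)))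

/-- Round `j` uses at most `t j + 1` ticks. Hence the last stored value is the initial one or `K j`
for a completed round `j`, and a clock exceeding the total for the rounds up to `J` guarantees that
round `J` is completed. -/
theorem exec_slowLoop {p : Cm} {K t : ℕ → ℕ} (hK : ∀ s, K s ≤ s)
    (hp : ∀ s : ℕ → ℕ, (∀ r ≠ 0, s r = 0) → ∃ T ≤ t (s 0), Run p s T (update s 1 (K (s 0))))
    (N n i c : ℕ) (σ : ℕ → List Bool) (hσ : σ 7 = List.replicate c true) (hN : i + n ≤ N)
    (hc : c ≤ N) :
    ∃ k s', Exec (slowLoop p) (regs σ n (update (fun _ => 0) 0 i))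
        (regs (update σ 7 (List.replicate k true)) 0 s') (n * (2 * p.cost + 10 * N + 20) + 1) ∧
      (∀ r ≥ max p.bound 2, s' r = 0) ∧ (k = c ∨ ∃ j, i ≤ j ∧ j < i + n ∧ k = K j) ∧
      ∀ J ≥ i, ∑ j ∈ Finset.Ico i (J + 1), (t j + 1) < n → ∃ j ≥ J, k = K j := by
  induction n using Nat.strong_induction_on generalizing i c σ with
  | _ n ih =>
  rcases n with - | n
  · refine ⟨c, update (fun _ => 0) 0 i,
      (Exec.while_nil (by simp [regs_eight])).congr ?_ (by simp),
      fun r hr => Function.update_of_ne (by simp at hr; omega) .., Or.inl rfl, fun J hJ h => ?_⟩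
    · rw [← hσ, Function.update_eq_self]
    · exact absurd h (Nat.not_lt_zero _)
  set s : ℕ → ℕ := update (fun _ => 0) 0 i with hs
  have hs0 : s 0 = i := by simp [hs]
  obtain ⟨T, hT, hr⟩ := hp s fun r hr => by simp [hs, Function.update_of_ne hr]
  rw [hs0] at hT hr
  obtain ⟨s₁, e₁, b₁, x₁⟩ := hr.exec σ n
  have hpop : Exec (.pop 8) (regs σ (n + 1) s) (regs σ n s) 1 :=
    (Exec.pop 8).congr (by
      rw [regs_eight, List.tail_replicate, update_regs_eight, Nat.add_sub_cancel]) le_rfl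
  have hne : regs σ (n + 1) s 8 ≠ [] := by simp [regs_eight]
  -- An empty clock does not reveal whether the computation was cut off, so a value is accepted only
  -- if a tick is left; hence the strict inequality.
  by_cases hTn : T < n
  · obtain rfl := e₁ hTn.le
    set σ₁ := update σ 7 (List.replicate (K i) true) with hσ₁
    have hK' := hK i
    have x₂ : Exec (.ifTrue 8 (.seq (clear 7) (.seq (moveRev 11 7) (.push 10 true))) .skip)
        (regs σ (n - T) (update s 1 (K i))) (regs σ₁ (n - T) (update (fun _ => 0) 0 (i + 1)))
        (7 * N + 7) := by
      refine Exec.congr (Exec.ifTrue_pos ?_ ((exec_clear 7 _).seq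
        ((exec_moveRev (by norm_num) _).seq (Exec.push _ _)))) ?_ ?_
      · rw [regs_eight, head?_replicate_eq_iff]
        omega
      · rw [update_regs_lt _ _ _ (by norm_num), regs_counter _ _ _ 1,
          regs_lt _ _ _ (by norm_num : 7 < 8), update_regs_lt _ _ _ (by norm_num),
          ← List.replicate_zero (a := true), update_regs_counter _ _ _ 1, regs_counter _ _ _ 0]
        rw [← List.replicate_succ, update_regs_counter _ _ _ 0]
        congr 1
        · simp [hσ₁]
        · ext1 r
          simp only [Function.update_apply, hs]
          split_ifs <;> simp_all
      · rw [regs_lt _ _ _ (by norm_num : 7 < 8), update_regs_lt _ _ _ (by norm_num),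
          regs_counter _ _ _ 1, hσ]
        simp
        omega
    obtain ⟨k, s', hx, hz, hk, hJ⟩ := ih (n - T) (by omega) (i + 1) (K i) σ₁ (by simp [hσ₁])
      (by omega) (by omega)
    refine ⟨k, s', (Exec.while_cons hne (hpop.seq (x₁.seq x₂)) hx).congr ?_ ?_, hz, Or.inr ?_, ?_⟩
    · rw [hσ₁, Function.update_idem]
    · obtain ⟨d, rfl⟩ : ∃ d, n = d + T := ⟨n - T, by omega⟩
      rw [Nat.add_sub_cancel, Nat.add_sub_cancel_left]
      nlinarith [Nat.zero_le (T * p.cost), Nat.zero_le (T * N)]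
    · rcases hk with rfl | ⟨j, hj, hj', rfl⟩
      · exact ⟨i, le_rfl, by omega, rfl⟩
      · exact ⟨j, by omega, by omega, rfl⟩
    · intro J hJi hsum
      rw [Finset.sum_eq_sum_Ico_succ_bot (by omega)] at hsum
      rcases hJi.eq_or_lt with rfl | hlt
      · rcases hk with rfl | ⟨j, hj, -, rfl⟩
        · exact ⟨i, le_rfl, rfl⟩
        · exact ⟨j, by omega, rfl⟩
      · exact hJ J hlt (by omega)
  · have h0 : n - T = 0 := by omega
    rw [h0] at x₁
    have x₂ : Exec (.ifTrue 8 (.seq (clear 7) (.seq (moveRev 11 7) (.push 10 true))) .skip)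
        (regs σ 0 s₁) (regs σ 0 s₁) 2 :=
      Exec.ifTrue_neg (by simp [regs_eight]) Exec.skip
    refine ⟨c, s₁, (Exec.while_cons hne (hpop.seq (x₁.seq x₂)) (Exec.while_nil ?_)).congr ?_ ?_,
      fun r hr => ?_, Or.inl rfl, fun J hJ hsum => ?_⟩
    · simp [regs_eight]
    · rw [← hσ, Function.update_eq_self]
    · rw [Nat.sub_zero]
      nlinarith [Nat.zero_le (n * p.cost), Nat.zero_le (n * N)]
    · simp only [ge_iff_le, sup_le_iff] at hr
      rw [b₁ r hr.1, hs, Function.update_of_ne (by omega)]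
    · rw [Finset.sum_eq_sum_Ico_succ_bot (by omega)] at hsum
      omega

end Cm

end QPC

namespace QPC

/-! ## Encodings -/

theorem length_encNat (n : ℕ) : (encNat n).length = n + 1 := by simp [encNat]

theorem encNat_succ (n : ℕ) : encNat (n + 1) = true :: encNat n := by
  simp [encNat, List.replicate_succ]

theorem encNat_append_inj {a b : ℕ} {r r' : List Bool} (h : encNat a ++ r = encNat b ++ r') :
    a = b ∧ r = r' := by
  induction a generalizing b with
  | zero => cases b <;> simp_all [encNat, List.replicate_succ]
  | succ a ih =>
    cases b with
    | zero => simp [encNat, List.replicate_succ] at h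
    | succ b =>
      rw [encNat_succ, encNat_succ, List.cons_append, List.cons_append, List.cons.injEq] at h
      obtain ⟨rfl, hr⟩ := ih h.2
      exact ⟨rfl, hr⟩

theorem flatMap_append_inj {α : Type*} {e : α → List Bool}
    (he : ∀ a b r r', e a ++ r = e b ++ r' → a = b ∧ r = r') {l l' : List α}
    (hl : l.length = l'.length) {r r' : List Bool} (h : l.flatMap e ++ r = l'.flatMap e ++ r') :
    l = l' ∧ r = r' := by
  induction l generalizing l' with
  | nil =>
    obtain rfl := List.length_eq_zero_iff.1 hl.symm
    exact ⟨rfl, by simpa using h⟩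
  | cons a l ih =>
    cases l' with
    | nil => simp at hl
    | cons b l' =>
      rw [List.flatMap_cons, List.flatMap_cons, List.append_assoc, List.append_assoc] at h
      obtain ⟨hab, h₁⟩ := he _ _ _ _ h
      obtain ⟨hll, h₂⟩ := ih (by simpa using hl) h₁
      exact ⟨by rw [hab, hll], h₂⟩

theorem encFins_append_inj {n : ℕ} {l l' : List (Fin n)} {r r' : List Bool}
    (h : encFins l ++ r = encFins l' ++ r') : l = l' ∧ r = r' := by
  rw [encFins, encFins, List.append_assoc, List.append_assoc] at h
  obtain ⟨hl, h⟩ := encNat_append_inj h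
  refine flatMap_append_inj (fun a b r r' h => ?_) hl h
  obtain ⟨hab, h⟩ := encNat_append_inj h
  exact ⟨Fin.ext hab, h⟩

variable {𝒢 : GateSet}

theorem Gate.encode_append_inj {n : ℕ} {g g' : Gate 𝒢 n} {r r' : List Bool}
    (h : g.encode ++ r = g'.encode ++ r') : g = g' ∧ r = r' := by
  cases g <;> cases g' <;> simp only [Gate.encode, List.append_assoc] at h <;>
    obtain ⟨h0, h⟩ := encNat_append_inj h <;> first | omega | skip
  · obtain ⟨h1, h⟩ := encNat_append_inj h
    obtain ⟨h2, h⟩ := encNat_append_inj h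
    rw [Fin.ext h1, Fin.ext h2]
    exact ⟨rfl, h⟩
  · obtain ⟨h1, h⟩ := encNat_append_inj h
    obtain ⟨h2, h⟩ := encNat_append_inj h
    obtain ⟨h3, h⟩ := encNat_append_inj h
    rw [Fin.ext h1, Fin.ext h2, Fin.ext h3]
    exact ⟨rfl, h⟩
  all_goals
    obtain ⟨h1, h⟩ := encNat_append_inj h
    obtain ⟨h2, h⟩ := encFins_append_inj h
    rw [Fin.ext h1, h2]
    exact ⟨rfl, h⟩

theorem Circuit.encode_injective : Function.Injective (Circuit.encode (𝒢 := 𝒢)) := by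
  rintro ⟨w, a, gs, o⟩ ⟨w', a', gs', o'⟩ h
  simp only [Circuit.encode, List.append_assoc] at h
  obtain ⟨rfl, h⟩ := encNat_append_inj h
  obtain ⟨rfl, h⟩ := encNat_append_inj h
  obtain ⟨ho, h⟩ := encNat_append_inj h
  obtain ⟨hl, h⟩ := encNat_append_inj h
  obtain ⟨rfl, -⟩ := flatMap_append_inj (r := []) (r' := [])
    (fun _ _ _ _ => Gate.encode_append_inj) hl (by rw [h])
  rw [Fin.ext ho]

theorem MiniInstance.unique {t k k' n n' : ℕ} {x : List Bool} {C C' : Circuit 𝒢}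
    (h : MiniInstance 𝒢 t x k n C) (h' : MiniInstance 𝒢 t x k' n' C') :
    k = k' ∧ n = n' ∧ C = C' := by
  have e := h.1.symm.trans h'.1
  rw [List.append_assoc, List.append_assoc] at e
  obtain ⟨hk, e⟩ := encNat_append_inj e
  obtain ⟨hn, e⟩ := encNat_append_inj e
  exact ⟨hk, hn, Circuit.encode_injective e⟩

theorem takeWhile_encNat_append (k : ℕ) (l : List Bool) :
    (encNat k ++ l).takeWhile id = List.replicate k true := by
  induction k with
  | zero => simp [encNat]
  | succ k ih => rw [encNat_succ, List.cons_append, List.takeWhile_cons_of_pos rfl, ih]; rfl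

theorem MiniInstance.param_eq {t k n : ℕ} {x : List Bool} {C : Circuit 𝒢}
    (h : MiniInstance 𝒢 t x k n C) (c s : ℕ → unitInterval) :
    (miniQCSAT 𝒢 t c s).param x = k := by
  have hk := h.2.1
  simp only [miniQCSAT]
  rw [h.1, List.append_assoc, takeWhile_encNat_append, List.length_replicate]
  omega

theorem Circuit.IsYes.not_isNo {C : Circuit 𝒢} {c s : ℕ → unitInterval} (hgap : PolyGap c s)
    (h : C.IsYes c) : ¬ C.IsNo s := by
  intro h'
  obtain ⟨ψ, hψ, hc⟩ := h
  obtain ⟨q, hq⟩ := hgap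
  obtain ⟨h0, h1⟩ := hq C.size
  have h2 : (0 : ℝ) < 1 / ((q.eval C.size : ℕ) : ℝ) := by positivity
  have := h' ψ hψ
  linarith

/-- The description size does not count the controls and targets of a gate. Since the wires of a
proper gate are distinct, there are at most as many as wires, which keeps codes polynomially long.
-/
theorem length_encFins_le {n : ℕ} {l : List (Fin n)} (hl : l.Nodup) :
    (encFins l).length ≤ n * (n + 1) + n + 1 := by
  have h1 : l.length ≤ n := by simpa using hl.length_le_card
  have h2 : (l.flatMap fun i => encNat i.val).length ≤ l.length * (n + 1) := by
    rw [List.length_flatMap]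
    refine (List.sum_le_card_nsmul _ (n + 1) fun m hm => ?_).trans (by simp)
    obtain ⟨i, -, rfl⟩ := List.mem_map.1 hm
    rw [length_encNat]
    omega
  have := Nat.mul_le_mul_right (n + 1) h1
  rw [encFins, List.length_append, length_encNat]
  omega

theorem Gate.length_encode_le {n : ℕ} {g : Gate 𝒢 n} (hg : g.Proper) :
    g.encode.length ≤ (𝒢.num₁ + 𝒢.num₂ + 12) * (n + 1) ^ 2 := by
  have h0 : (𝒢.num₁ + 𝒢.num₂ + 12) * (n + 1) ^ 2 = (𝒢.num₁ + 𝒢.num₂) * (n + 1) ^ 2 +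
    12 * n * n + 24 * n + 12 := by ring
  have h1 := Nat.le_mul_of_pos_right (𝒢.num₁ + 𝒢.num₂) (show 0 < (n + 1) ^ 2 by positivity)
  have h2 : n * (n + 1) = n * n + n := by ring
  have h3 : 12 * n * n = 12 * (n * n) := by ring
  cases g with
  | one i q =>
    simp only [Gate.encode, List.length_append, length_encNat]
    omega
  | two i q r =>
    simp only [Gate.encode, List.length_append, length_encNat]
    omega
  | toffoli cs t =>
    have := length_encFins_le (List.nodup_cons.1 hg).2
    simp only [Gate.encode, List.length_append, length_encNat]
    omega
  | fanout c ts =>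
    have := length_encFins_le (List.nodup_cons.1 hg).2
    simp only [Gate.encode, List.length_append, length_encNat]
    omega

theorem Circuit.length_encode_le {C : Circuit 𝒢} (hC : C.Valid) :
    C.encode.length ≤ (𝒢.num₁ + 𝒢.num₂ + 20) * (C.size + 1) ^ 3 := by
  have hw : C.witness + C.ancilla ≤ C.size := le_max_left _ _
  have hg : C.gates.length ≤ C.size := le_max_right _ _
  have ho := C.out.isLt
  have h1 : (C.gates.flatMap Gate.encode).length ≤
      C.gates.length * ((𝒢.num₁ + 𝒢.num₂ + 12) * (C.size + 1) ^ 2) := by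
    rw [List.length_flatMap]
    refine (List.sum_le_card_nsmul _ ((𝒢.num₁ + 𝒢.num₂ + 12) * (C.size + 1) ^ 2)
      fun m hm => ?_).trans (by simp)
    obtain ⟨g, hg, rfl⟩ := List.mem_map.1 hm
    refine (Gate.length_encode_le (hC.1 g hg)).trans ?_
    gcongr
  have h2 := h1.trans (Nat.mul_le_mul_right _ hg)
  simp only [Circuit.encode, List.length_append, length_encNat]
  generalize C.size = s at *
  have h3 : (𝒢.num₁ + 𝒢.num₂ + 20) * (s + 1) ^ 3 = s * ((𝒢.num₁ + 𝒢.num₂ + 12) * (s + 1) ^ 2) +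
    ((𝒢.num₁ + 𝒢.num₂ + 12) * (s + 1) ^ 2) + 8 * (s * s * s) + 24 * (s * s) + 24 * s + 8 := by ring
  omega

/-! ## Programs on finitely many registers -/

/-- The registers with the given contents; all others are empty. -/
def mem (l : List (List Bool)) : ℕ → List Bool := fun j => l.getD j []

theorem update_mem {l : List (List Bool)} {j : ℕ} (hj : j < l.length) (v : List Bool) :
    Function.update (mem l) j v = mem (l.set j v) := by
  ext1 i
  rw [Function.update_apply]
  split_ifs with h
  · subst h
    simp [mem, hj]
  · simp [mem, Ne.symm h]

theorem inputRegs_eq_mem (x : List Bool) (n : ℕ) :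
    inputRegs x = mem (x :: List.replicate n []) := by
  ext1 i
  rcases i with - | i
  · simp [inputRegs, mem]
  · simp only [inputRegs, mem, List.getD_cons_succ]
    rw [Function.update_of_ne (by omega)]
    simp only [List.getD_eq_getElem?_getD, List.getElem?_replicate]
    split_ifs <;> rfl

section

variable (l : List (List Bool))

theorem exec_push_mem (j : ℕ) (c : Bool) (hj : j < l.length) :
    Exec (.push j c) (mem l) (mem (l.set j (c :: l.getD j []))) 1 :=
  (Exec.push j c).congr (update_mem hj _) le_rfl

theorem exec_pop_mem (j : ℕ) (hj : j < l.length) :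
    Exec (.pop j) (mem l) (mem (l.set j (l.getD j []).tail)) 1 :=
  (Exec.pop j).congr (update_mem hj _) le_rfl

theorem exec_moveRev_mem (i j : ℕ) (hi : i < l.length) (hj : j < l.length) (hij : i ≠ j) :
    Exec (moveRev i j) (mem l)
      (mem ((l.set j ((l.getD i []).reverse ++ l.getD j [])).set i [])) (5 * (l.getD i []).length + 1) :=
  (exec_moveRev hij (mem l)).congr (by
    rw [update_mem hj, update_mem (by simpa using hi)]
    rfl) le_rfl

end

theorem Exec.outProb_ge {p : Prog} {x y : List Bool} {σ : ℕ → List Bool} {B T : ℕ}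
    (h : Exec p (inputRegs x) σ B) (hy : σ 1 = y) (hT : B ≤ T) : p.outProb x T y = 1 :=
  hy ▸ (h.mono hT).outProb_eq_one

/-! ## The identity as a reduction -/

theorem exec_copy_input (x : List Bool) :
    Exec (.seq (moveRev 0 2) (moveRev 2 1)) (inputRegs x) (mem [[], x, []]) (10 * x.length + 3) := by
  rw [inputRegs_eq_mem x 2]
  refine ((exec_moveRev_mem _ 0 2 (by simp) (by simp) (by simp)).seq
    (exec_moveRev_mem _ 2 1 (by simp) (by simp) (by simp))).congr ?_ ?_
  · simp
  · simp; omega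

theorem FPQTReducible.refl (P : ParamProblem) : FPQTReducible P P := by
  refine ⟨id, id, Computable.id, fun _ h => h, fun _ h => h, fun _ _ => le_rfl, fun ε hε =>
    ⟨.seq (moveRev 0 2) (moveRev 2 1), fun _ => 1, 10 * Polynomial.X + 3, Computable.const 1,
      fun x _ => ?_⟩⟩
  rw [(exec_copy_input x).outProb_ge (y := id x) rfl (by simp)]
  linarith

/-! ## The parameter is computable in polynomial time -/

/-- Binary successor, least significant bit first. -/
def incBits (l : List Bool) : List Bool :=
  (l.takeWhile id).map (fun _ => false) ++ true :: (l.dropWhile id).tail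

theorem incBits_bits (n : ℕ) : incBits n.bits = (n + 1).bits := by
  induction n using Nat.binaryRec' with
  | zero => simp [incBits]
  | bit b n h ih =>
    rw [Nat.bits_append_bit n b h]
    cases b
    · rw [show Nat.bit false n + 1 = Nat.bit true n by simp [Nat.bit_val],
        Nat.bits_append_bit n true (by simp)]
      simp [incBits]
    · rw [show Nat.bit true n + 1 = Nat.bit false (n + 1) by simp [Nat.bit_val]; ring,
        Nat.bits_append_bit (n + 1) false (by simp), ← ih]
      simp [incBits]

/-- Add one to the binary number in register `1`. -/
def incProg : Prog :=
  .seq (.push 3 true) (.seq (.whileNonempty 3 (.ifTrue 1 (.seq (.pop 1) (.push 2 false)) (.pop 3)))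
    (.seq (.pop 1) (.seq (.push 1 true) (moveRev 2 1))))

theorem exec_incProg_loop (x l a f : List Bool) :
    Exec (.whileNonempty 3 (.ifTrue 1 (.seq (.pop 1) (.push 2 false)) (.pop 3)))
      (mem [x, l, a, [true], f])
      (mem [x, l.dropWhile id, (l.takeWhile id).map (fun _ => false) ++ a, [], f])
      (5 * l.length + 4) := by
  induction l generalizing a with
  | nil =>
    refine (Exec.while_cons (by simp [mem]) (Exec.ifTrue_neg (by simp [mem])
      (exec_pop_mem _ 3 (by simp))) (Exec.while_nil (by simp [mem]))).congr (by simp) (by simp)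
  | cons b l ih =>
    cases b
    · refine (Exec.while_cons (by simp [mem]) (Exec.ifTrue_neg (by simp [mem])
        (exec_pop_mem _ 3 (by simp))) (Exec.while_nil (by simp [mem]))).congr (by simp) (by simp)
    · refine (Exec.while_cons (by simp [mem]) (Exec.ifTrue_pos (by simp [mem])
        ((exec_pop_mem _ 1 (by simp)).seq (exec_push_mem _ 2 false (by simp))))
        (ih (false :: a))).congr ?_ ?_
      · have : ∀ n, List.replicate n false ++ false :: a = false :: (List.replicate n false ++ a) :=
          fun n => by
            rw [← List.cons_append, ← List.replicate_succ, List.replicate_succ', List.append_assoc]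
            rfl
        simp [this]
      · simp; omega

/-- Register `2` collects only zeros, the carried-over ones, so the reversal by `moveRev` does no
harm. -/
theorem exec_incProg (x l f : List Bool) :
    Exec incProg (mem [x, l, [], [], f]) (mem [x, incBits l, [], [], f]) (10 * l.length + 14) := by
  refine ((exec_push_mem _ 3 true (by simp)).seq ((exec_incProg_loop x l [] f).seq
    ((exec_pop_mem _ 1 (by simp)).seq ((exec_push_mem _ 1 true (by simp)).seq
      (exec_moveRev_mem _ 2 1 (by simp) (by simp) (by simp)))))).congr ?_ ?_
  · simp [incBits]
  · have := (List.takeWhile_prefix (id : Bool → Bool) (l := l)).length_le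
    simp
    omega

theorem length_bits_le (n : ℕ) : n.bits.length ≤ n := by
  rw [Nat.size_eq_bits_len, Nat.size_le]
  exact Nat.lt_two_pow_self

theorem exec_countOnes (x : List Bool) (c : ℕ) :
    Exec (.whileNonempty 4 (.ifTrue 0 (.seq (.pop 0) incProg) (.pop 4)))
      (mem [x, c.bits, [], [], [true]])
      (mem [x.dropWhile id, (c + (x.takeWhile id).length).bits, [], [], []])
      ((x.length + 1) * (10 * (c + x.length) + 20)) := by
  induction x generalizing c with
  | nil =>
    exact (Exec.while_cons (by simp [mem]) (Exec.ifTrue_neg (by simp [mem])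
      (exec_pop_mem _ 4 (by simp))) (Exec.while_nil (by simp [mem]))).congr (by simp)
      (by simp)
  | cons b x ih =>
    cases b
    · exact (Exec.while_cons (by simp [mem]) (Exec.ifTrue_neg (by simp [mem])
        (exec_pop_mem _ 4 (by simp))) (Exec.while_nil (by simp [mem]))).congr (by simp)
        (by simp; nlinarith)
    · have h := ih (c + 1)
      rw [← incBits_bits] at h
      refine (Exec.while_cons (by simp [mem]) (Exec.ifTrue_pos (by simp [mem])
        ((exec_pop_mem _ 0 (by simp)).seq (exec_incProg _ _ _))) h).congr ?_ ?_
      · simp [Nat.add_assoc, Nat.add_comm 1]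
      · have := length_bits_le c
        simp
        nlinarith

theorem polyTimeComputable_ones :
    PolyTimeComputable fun x => max 1 (x.takeWhile id).length := by
  refine ⟨.ifTrue 0 (.seq (.push 4 true)
    (.whileNonempty 4 (.ifTrue 0 (.seq (.pop 0) incProg) (.pop 4)))) (.push 1 true),
    (Polynomial.X + 1) * (10 * Polynomial.X + 20) + 10, ?_, fun x => ?_⟩
  · simp [Prog.IsClassical, incProg, moveRev, forBits]
  rcases x with - | ⟨- | -, x⟩
  · exact (Exec.ifTrue_neg (by simp [inputRegs]) (Exec.push 1 true)).outProb_ge (by simp [inputRegs])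
      (by simp)
  · exact (Exec.ifTrue_neg (by simp [inputRegs]) (Exec.push 1 true)).outProb_ge (by simp [inputRegs])
      (by simp)
  · have h := exec_countOnes (true :: x) 0
    rw [zero_add, Nat.zero_bits] at h
    have e := inputRegs_eq_mem (true :: x) 4
    refine Exec.outProb_ge (σ := mem [(true :: x).dropWhile id,
      ((true :: x).takeWhile id).length.bits, [], [], []])
      (B := ((true :: x).length + 1) * (10 * (0 + (true :: x).length) + 20) + 3) ?_ ?_ ?_
    · rw [e]
      exact (Exec.ifTrue_pos (by simp [mem]) ((exec_push_mem _ 4 true (by simp)).seq h)).mono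
        (by omega)
    · simp [mem]
    · simp

/-- Disjointness combines unique decoding of instances with the gap between completeness and
soundness. -/
theorem miniQCSAT_wellFormed (t : ℕ) {c s : ℕ → unitInterval} (hgap : PolyGap c s) :
    (miniQCSAT 𝒢 t c s).WellFormed := by
  refine ⟨Set.disjoint_left.2 ?_, fun x => by simp [miniQCSAT], polyTimeComputable_ones⟩
  rintro x ⟨k, n, C, h, hy⟩ ⟨k', n', C', h', hn⟩
  obtain ⟨-, -, rfl⟩ := h.unique h'
  exact hy.not_isNo hgap hn

theorem miniQCSAT_mem_QM (t : ℕ) {c s : ℕ → unitInterval} (h : Admissible c s) :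
    miniQCSAT 𝒢 t c s ∈ QM 𝒢 t :=
  ⟨c, s, h, miniQCSAT_wellFormed t h.2.2, FPQTReducible.refl _⟩

end QPC

namespace QPC

open List (replicate)

/-! ## Preparing an instance with a slowly growing parameter -/

/-- The registers while the input is scanned: unread input, reversed read input, counters. -/
def scanRegs (x s : List Bool) (c : ℕ) (fl : List Bool) : ℕ → List Bool :=
  mem [x, s, [], [], [], [], replicate c true, [], replicate c true, fl]

/-- Read a unary number from register `0`, add it to the registers `6` and `8`, and push what has
been read onto register `1`. -/
def scanNat : Prog :=
  .seq (.push 9 true) (.whileNonempty 9 (.ifTrue 0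
    (.seq (.pop 0) (.seq (.push 1 true) (.seq (.push 6 true) (.push 8 true))))
    (.seq (.pop 0) (.seq (.push 1 false) (.pop 9)))))

theorem exec_scanNat (n : ℕ) (l s : List Bool) (c : ℕ) :
    Exec scanNat (scanRegs (encNat n ++ l) s c []) (scanRegs l ((encNat n).reverse ++ s) (c + n) [])
      (10 * n + 12) := by
  suffices H : Exec (.whileNonempty 9 (.ifTrue 0
      (.seq (.pop 0) (.seq (.push 1 true) (.seq (.push 6 true) (.push 8 true))))
      (.seq (.pop 0) (.seq (.push 1 false) (.pop 9))))) (scanRegs (encNat n ++ l) s c [true])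
      (scanRegs l ((encNat n).reverse ++ s) (c + n) []) (10 * n + 10) from
    ((exec_push_mem _ 9 true (by simp)).seq H).mono (by omega)
  induction n generalizing s c with
  | zero =>
    exact (Exec.while_cons (by simp [mem]) (Exec.ifTrue_neg (by simp [mem, encNat])
      ((exec_pop_mem _ 0 (by simp)).seq ((exec_push_mem _ 1 false (by simp)).seq
        (exec_pop_mem _ 9 (by simp))))) (Exec.while_nil (by simp [mem]))).congr
        (by simp [scanRegs, encNat]) (by omega)
  | succ n ih =>
    refine (Exec.while_cons (by simp [mem]) (Exec.ifTrue_pos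
      (by simp [mem, encNat_succ])
      ((exec_pop_mem _ 0 (by simp)).seq ((exec_push_mem _ 1 true (by simp)).seq
        ((exec_push_mem _ 6 true (by simp)).seq (exec_push_mem _ 8 true (by simp))))))
      (ih (true :: s) (c + 1))).congr ?_ (by omega)
    rw [encNat_succ, Nat.add_assoc, Nat.add_comm 1]
    simp

/-- The sum of all numbers at the beginning of the code of a circuit; it lies between the size and
three times the size. -/
def Circuit.weight {𝒢 : GateSet} (C : Circuit 𝒢) : ℕ :=
  C.witness + C.ancilla + C.out.val + C.gates.length

/-- Compute the weight of the encoded circuit. -/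
def scanCircuit : Prog :=
  .seq scanNat (.seq scanNat (.seq scanNat (.seq scanNat (moveRev 1 0))))

variable {𝒢 : GateSet}

/-- The weight stands in for the size because a sum of unary numbers accumulates while they are
read. It is stored twice: register `6` feeds the division by the parameter and register `8` is the
clock. -/
theorem exec_scanCircuit (C : Circuit 𝒢) :
    Exec scanCircuit (inputRegs C.encode) (scanRegs C.encode [] C.weight [])
      (10 * C.weight + 5 * C.encode.length + 60) := by
  rw [inputRegs_eq_mem _ 9]
  set G := C.gates.flatMap Gate.encode with hG
  have e : C.encode = encNat C.witness ++ (encNat C.ancilla ++ (encNat C.out.val ++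
    (encNat C.gates.length ++ G))) := by simp [Circuit.encode, hG]
  rw [e]
  refine ((exec_scanNat C.witness _ [] 0).seq ((exec_scanNat C.ancilla _ _ _).seq
    ((exec_scanNat C.out.val _ _ _).seq ((exec_scanNat C.gates.length _ _ _).seq
      (exec_moveRev_mem _ 1 0 (by simp) (by simp) (by simp)))))).congr ?_ ?_
  · simp [scanRegs, Circuit.weight, Nat.add_assoc]
  · simp [Circuit.weight]
    omega

theorem scanRegs_eq_regs (x : List Bool) (c : ℕ) :
    scanRegs x [] c [] =
      Cm.regs (mem [x, [], [], [], [], [], replicate c true, []]) c fun _ => 0 := by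
  ext1 j
  by_cases hj : j < 10
  · interval_cases j <;> rfl
  · obtain ⟨i, rfl⟩ : ∃ i, j = i + 10 := ⟨j - 10, by omega⟩
    rw [Cm.regs_counter]
    simp [scanRegs, mem]

/-! ### Padding: the power of two and the assembled instance -/

/-- The registers while the power of two is computed. -/
def divRegs (x : List Bool) (m k n : ℕ) (a : List Bool) : ℕ → List Bool :=
  mem [x, [], [], [], a, replicate n true, replicate m true, replicate k true, [], []]

/-- Subtract the unary number in register `7` from that in register `6`. -/
def subLoop : Prog := .whileNonempty 7 (.seq (.pop 7) (.seq (.pop 6) (.push 4 true)))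

theorem exec_subLoop (x : List Bool) (m k n c : ℕ) :
    Exec subLoop (divRegs x m k n (replicate c true)) (divRegs x (m - k) 0 n (replicate (c + k) true))
      (6 * k + 1) := by
  induction k generalizing m c with
  | zero => exact (Exec.while_nil (by simp [divRegs, mem])).congr rfl (by omega)
  | succ k ih =>
    have body : Exec (.seq (.pop 7) (.seq (.pop 6) (.push 4 true)))
        (divRegs x m (k + 1) n (replicate c true))
        (divRegs x (m - 1) k n (replicate (c + 1) true)) 5 :=
      ((exec_pop_mem _ 7 (by simp)).seq ((exec_pop_mem _ 6 (by simp)).seq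
        (exec_push_mem _ 4 true (by simp)))).congr (by simp [divRegs, List.replicate_succ]) le_rfl
    refine (Exec.while_cons (by simp [divRegs, mem]) body (ih (m - 1) (c + 1))).congr ?_ (by omega)
    rw [Nat.sub_sub, Nat.add_assoc, Nat.add_comm 1]

/-- Move twice the unary number in register `5` to register `4`. -/
def doubleLoop : Prog := .whileNonempty 5 (.seq (.pop 5) (.seq (.push 4 true) (.push 4 true)))

theorem exec_doubleLoop (x : List Bool) (m k n c : ℕ) :
    Exec doubleLoop (divRegs x m k n (replicate c true)) (divRegs x m k 0 (replicate (c + 2 * n) true))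
      (6 * n + 1) := by
  induction n generalizing c with
  | zero => exact (Exec.while_nil (by simp [divRegs, mem])).congr rfl (by omega)
  | succ n ih =>
    refine (Exec.while_cons (by simp [mem]) ((exec_pop_mem _ 5 (by simp)).seq
      ((exec_push_mem _ 4 true (by simp)).seq (exec_push_mem _ 4 true (by simp))))
        (σ₁ := divRegs x m k n (replicate (c + 2) true)) (ih (c + 2))).congr ?_ (by omega)
    rw [show c + 2 * (n + 1) = c + 2 + 2 * n by ring]

/-- Multiply the unary number in register `5` by `2 ^ ⌈m / k⌉`, where `m` and `k` are the unary
numbers in the registers `6` and `7`. -/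
def powLoop : Prog :=
  .whileNonempty 6 (.seq subLoop (.seq (moveRev 4 7) (.seq doubleLoop (moveRev 4 5))))

/-- Each round subtracts `k` from `m` and doubles `n`; the first two inequalities say that the
number `e` of rounds is ⌈m/k⌉. -/
theorem exec_powLoop (x : List Bool) {k : ℕ} (hk : 0 < k) (m n : ℕ) :
    ∃ e, m ≤ k * e ∧ k * e < m + k ∧ e ≤ m ∧
      Exec powLoop (divRegs x m k n []) (divRegs x 0 k (n * 2 ^ e) [])
        (e * (11 * k + 20 * (n * 2 ^ e) + 20) + 1) := by
  induction m using Nat.strong_induction_on generalizing n with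
  | _ m ih =>
  rcases m with - | m
  · exact ⟨0, le_rfl, by omega, le_rfl, (Exec.while_nil (by simp [divRegs, mem])).congr
      (by simp) (by omega)⟩
  obtain ⟨e, h₁, h₂, h₃, h⟩ := ih (m + 1 - k) (by omega) (2 * n)
  have e1 : 2 * n * 2 ^ e = n * 2 ^ (e + 1) := by ring
  rw [e1] at h
  have hke : k * (e + 1) = k * e + k := by ring
  refine ⟨e + 1, by omega, ?_, by omega, ?_⟩
  -- Only truncation in `m + 1 - k` could spoil the bound; for positive `e` it would give `k * e <
  -- k`.
  · rcases Nat.eq_zero_or_pos e with rfl | he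
    · omega
    · have := Nat.le_mul_of_pos_right k he
      omega
  have b₂ : Exec (moveRev 4 7) (divRegs x (m + 1 - k) 0 n (replicate (0 + k) true))
      (divRegs x (m + 1 - k) k n []) (5 * k + 1) :=
    (exec_moveRev_mem _ 4 7 (by simp) (by simp) (by simp)).congr (by simp [divRegs]) (by simp)
  have b₄ : Exec (moveRev 4 5) (divRegs x (m + 1 - k) k 0 (replicate (0 + 2 * n) true))
      (divRegs x (m + 1 - k) k (2 * n) []) (10 * n + 1) :=
    (exec_moveRev_mem _ 4 5 (by simp) (by simp) (by simp)).congr (by simp [divRegs])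
      (by simp; omega)
  refine (Exec.while_cons (by simp [divRegs, mem]) ((exec_subLoop x (m + 1) k n 0).seq
    (b₂.seq ((exec_doubleLoop x _ k n 0).seq b₄))) h).congr rfl ?_
  have : n ≤ n * 2 ^ (e + 1) := Nat.le_mul_of_pos_right _ (by positivity)
  rw [Nat.add_mul e]
  omega

/-- From the code of a circuit in register `0`, the power of two in register `5` and the parameter in
register `7`, assemble the instance. -/
def assemble : Prog :=
  .seq (.push 0 false) (.seq (moveRev 5 0) (.seq (.push 0 false) (moveRev 7 0)))

theorem exec_assemble (x : List Bool) (k n : ℕ) :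
    Exec assemble (divRegs x 0 k n []) (inputRegs (encNat k ++ encNat n ++ x))
      (5 * k + 5 * n + 7) := by
  rw [inputRegs_eq_mem _ 9]
  refine ((exec_push_mem _ 0 false (by simp)).seq ((exec_moveRev_mem _ 5 0 (by simp) (by simp)
    (by simp)).seq ((exec_push_mem _ 0 false (by simp)).seq (exec_moveRev_mem _ 7 0 (by simp)
      (by simp) (by simp))))).congr ?_ ?_
  · simp [encNat]
  · simp; omega

/-- The whole preparation; `p` computes a slowly growing function. -/
def prepare (p : Cm) : Prog :=
  .seq scanCircuit (.seq (Cm.slowLoop p) (.seq (clearRange 10 (max p.bound 2))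
    (.seq (.ifTrue 7 .skip (.push 7 true)) (.seq (.push 5 true) (.seq powLoop assemble)))))

/-- The parameter is the outcome of the slow loop with the weight as clock, raised to at least `1`;
the summand `f 1` covers the case where it is raised. The exponent `e` makes `2 ^ e` just large
enough for an instance with this parameter. -/
theorem exists_prepare {f : ℕ → ℕ} (hf : Computable f) :
    ∃ (P : Prog) (A : ℕ) (M : ℕ → ℕ), Computable M ∧ ∀ C : Circuit 𝒢, ∃ k e, 0 < k ∧
      k ≤ C.weight + 1 ∧ f k ≤ C.weight + f 1 ∧ (∀ j, M j ≤ C.weight → j ≤ k) ∧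
      C.weight ≤ k * e ∧ k * e < C.weight + k ∧
      Exec P (inputRegs C.encode) (inputRegs (encNat k ++ encNat (2 ^ e) ++ C.encode))
        (A * (C.encode.length + C.weight + 1) ^ 2 * 2 ^ e) := by
  obtain ⟨K, M, pK, cM, hKle, hKf, hKM⟩ := exists_slow hf
  obtain ⟨t, p, pt, hp⟩ := Cm.exists_run_of_primrec pK
  set B := max p.bound 2 with hB
  refine ⟨prepare p, 300 + (2 * p.cost + 40) + B * (4 * p.cost + 100),
    -- With this many ticks the slow loop completes round `M j`, and from there on `K` is at least
    -- `j`.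
    fun j => ∑ i ∈ Finset.range (M j + 1), (t i + 1) + 1, ?_, fun C => ?_⟩
  · exact Computable.succ.comp ((computable_sum_range
      (Primrec.succ.comp pt).to_comp).comp (Computable.succ.comp cM))
  set m := C.weight with hm
  set x := C.encode with hx
  set σ := mem [x, [], [], [], [], [], replicate m true, []] with hσ
  obtain ⟨k₀, s', h₂, hz, hk, hJ⟩ := Cm.exec_slowLoop hKle hp m m 0 0 σ rfl (by omega) (by omega)
  rw [Function.update_eq_self_iff.2 rfl, ← scanRegs_eq_regs] at h₂
  have hk₀ : k₀ ≤ m := by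
    rcases hk with rfl | ⟨j, -, hj, rfl⟩
    · omega
    · have := hKle j
      omega
  set k := max k₀ 1 with hkdef
  have hfk : f k ≤ m + f 1 := by
    rcases Nat.eq_zero_or_pos k₀ with h0 | h0
    · rw [hkdef, h0]
      simp
    · rw [show k = k₀ by omega]
      rcases hk with rfl | ⟨j, -, hj, rfl⟩
      · omega
      · have := hKf j (by omega)
        omega
  have hMk : ∀ j, ∑ i ∈ Finset.range (M j + 1), (t i + 1) + 1 ≤ m → j ≤ k := by
    intro j hj
    obtain ⟨i, hi, h⟩ := hJ (M j) (Nat.zero_le _) (by rw [Nat.Ico_zero_eq_range]; omega)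
    have := hKM j i hi
    omega
  have h₁ := exec_scanCircuit C
  obtain ⟨e, he₁, he₂, he₃, h₆⟩ := exec_powLoop x (show 0 < k by omega) m 1
  set L := x.length + m + (m * (2 * p.cost + 10 * m + 20) + 1) with hL
  have hlen : ∀ r, (Cm.regs (Function.update σ 7 (replicate k₀ true)) 0 s' r).length ≤ L := by
    intro r
    refine (h₂.length_le r).trans ?_
    suffices (scanRegs x [] m [] r).length ≤ x.length + m by omega
    by_cases hr : r < 10
    · interval_cases r <;> simp [scanRegs, mem]
    · have : scanRegs x [] m [] r = [] := by
        unfold scanRegs mem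
        rw [List.getD_eq_default _ _ (by simp; omega)]
      simp [this]
  have h₃ := exec_clearRange 10 B L _ hlen
  -- An interrupted computation leaves unknown values in its counters. They all lie below `B`, so
  -- clearing this range restores a known state.
  have hst : (fun r => if 10 ≤ r ∧ r < 10 + B then [] else
      Cm.regs (Function.update σ 7 (replicate k₀ true)) 0 s' r) = divRegs x m k₀ 0 [] := by
    ext1 r
    by_cases hr : r < 10
    · rw [if_neg (by omega)]
      interval_cases r <;> rfl
    · obtain ⟨i, rfl⟩ : ∃ i, r = i + 10 := ⟨r - 10, by omega⟩
      have hd : divRegs x m k₀ 0 [] (i + 10) = [] := by simp [divRegs, mem]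
      rw [hd]
      split_ifs with h
      · rfl
      · rw [Cm.regs_counter, hz i (by omega), List.replicate_zero]
  rw [hst] at h₃
  have h₄ : Exec (.ifTrue 7 .skip (.push 7 true)) (divRegs x m k₀ 0 []) (divRegs x m k 0 []) 2 := by
    rcases Nat.eq_zero_or_pos k₀ with h0 | h0
    · rw [hkdef, h0]
      exact Exec.ifTrue_neg (by simp [divRegs, mem]) (exec_push_mem _ 7 true (by simp))
    · rw [show k = k₀ by omega]
      refine Exec.ifTrue_pos ?_ Exec.skip
      show (replicate k₀ true).head? = _
      rw [Cm.head?_replicate_eq_iff]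
      omega
  have h₅ : Exec (.push 5 true) (divRegs x m k 0 []) (divRegs x m k 1 []) 1 :=
    exec_push_mem _ 5 true (by simp)
  rw [one_mul] at h₆
  refine ⟨k, e, by omega, by omega, hfk, hMk, he₁, he₂, (h₁.seq (h₂.seq (h₃.seq (h₄.seq (h₅.seq
    (h₆.seq (exec_assemble x k (2 ^ e)))))))).mono ?_⟩
  have hk1 : k ≤ m + 1 := by omega
  clear_value k L B
  rw [← hx]
  generalize x.length = l at *
  generalize p.cost = c at *
  have hE : 1 ≤ 2 ^ e := Nat.one_le_two_pow
  generalize 2 ^ e = E at *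
  obtain ⟨S, hS⟩ : ∃ S, S = l + m + 1 := ⟨_, rfl⟩
  rw [← hS]
  have hl : l ≤ S := by omega
  have hmS : m ≤ S := by omega
  have hS1 : 1 ≤ S := by omega
  have a1 : S ≤ S ^ 2 := by nlinarith
  have a2 : S ^ 2 ≤ S ^ 2 * E := Nat.le_mul_of_pos_right _ hE
  have a3 : L ≤ (2 * c + 35) * S ^ 2 := by
    have : m * (2 * c + 10 * m + 20) ≤ S * (2 * c + 10 * S + 20) := by gcongr
    nlinarith [Nat.mul_le_mul_left c a1]
  have a4 : B * (2 * L + 2) ≤ B * (4 * c + 100) * (S ^ 2 * E) := by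
    rw [Nat.mul_assoc]
    refine Nat.mul_le_mul_left _ ?_
    have : (4 * c + 100) * S ^ 2 ≤ (4 * c + 100) * (S ^ 2 * E) := Nat.mul_le_mul_left _ a2
    nlinarith
  have a5 : e * (11 * k + 20 * E + 20) ≤ 62 * (S ^ 2 * E) := by
    have : e * (11 * k + 20 * E + 20) ≤ S * (11 * S + 20 * E + 20) := by
      gcongr
      · omega
      · omega
    have : S * E ≤ S ^ 2 * E := Nat.mul_le_mul_right _ a1
    nlinarith
  have a6 : m * (2 * c + 10 * m + 20) ≤ (2 * c + 35) * (S ^ 2 * E) := by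
    refine le_trans ?_ (Nat.mul_le_mul_left _ a2)
    omega
  have a7 : E ≤ S ^ 2 * E := Nat.le_mul_of_pos_left _ (by positivity)
  rw [Nat.mul_assoc, Nat.add_mul, Nat.add_mul]
  have a8 : (2 * c + 40) * (S ^ 2 * E) = (2 * c + 35) * (S ^ 2 * E) + 5 * (S ^ 2 * E) := by ring
  omega

end QPC

namespace QPC

/-! ## From fixed-parameter to subexponential algorithms -/

theorem polynomial_eval_le (q : Polynomial ℕ) {y z : ℕ} (hyz : y ≤ z) (hz : 1 ≤ z) :
    q.eval y ≤ q.eval 1 * z ^ q.natDegree := by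
  rw [Polynomial.eval_eq_sum_range, Polynomial.eval_eq_sum_range, Finset.sum_mul]
  refine Finset.sum_le_sum fun i hi => ?_
  rw [one_pow, mul_one]
  refine Nat.mul_le_mul_left _ ((Nat.pow_le_pow_left hyz i).trans (Nat.pow_le_pow_right hz ?_))
  exact Nat.lt_succ_iff.1 (Finset.mem_range.1 hi)

/-- Turns polynomial factors into powers of two with an exponent that is effectively o(s). -/
theorem le_two_pow_sqrt (s : ℕ) : s + 1 ≤ 2 ^ (2 * s.sqrt) := by
  have h1 : s + 1 ≤ (s.sqrt + 1) ^ 2 := by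
    have := Nat.lt_succ_sqrt s
    rw [pow_two]
    exact this
  have h2 : s.sqrt + 1 ≤ 2 ^ s.sqrt := Nat.lt_two_pow_self
  calc s + 1 ≤ (s.sqrt + 1) ^ 2 := h1
    _ ≤ (2 ^ s.sqrt) ^ 2 := Nat.pow_le_pow_left h2 2
    _ = 2 ^ (2 * s.sqrt) := by rw [← pow_mul, mul_comm]

open Classical in
/-- The exponent `D * (2 + 2 * √m + 3 * m / K)`, where `K ≥ 1` is the largest number up to `m` with
`M K ≤ m`, if there is one. -/
noncomputable def slowExponent (D : ℕ) (M : ℕ → ℕ) (m : ℕ) : ℕ :=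
  D * (2 + 2 * m.sqrt + 3 * m / max 1 (Nat.findGreatest (fun j => M j ≤ m) m))

/-- Put a = jD. Once K ≥ 6a + 1, the term a · 3m/K is at most m/2; once √m ≥ 8a + 1, the terms 2a +
2a√m are at most 4a√m ≤ m/2. The threshold enforces both. -/
theorem effLittleO_slowExponent (D : ℕ) {M : ℕ → ℕ} (hM : Computable M) :
    EffLittleO (slowExponent D M) := by
  classical
  refine ⟨fun j => M (6 * (j * D) + 1) + (6 * (j * D) + 1) + (8 * (j * D) + 1) * (8 * (j * D) + 1),
    ?_, fun j m hm => ?_⟩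
  · have c1 : Computable fun j => j * D :=
      (Primrec.nat_mul.comp Primrec.id (Primrec.const D)).to_comp
    have c2 : ∀ a : ℕ, Computable fun j => a * (j * D) + 1 := fun a =>
      Computable.succ.comp (Primrec.nat_mul.to_comp.comp (Computable.const a) c1)
    exact Primrec.nat_add.to_comp.comp (Primrec.nat_add.to_comp.comp (hM.comp (c2 6)) (c2 6))
      (Primrec.nat_mul.to_comp.comp (c2 8) (c2 8))
  · unfold slowExponent
    beta_reduce at hm
    have hG : 6 * (j * D) + 1 ≤ Nat.findGreatest (fun j => M j ≤ m) m :=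
      Nat.le_findGreatest (by omega) (show M _ ≤ m by omega)
    set K := max 1 (Nat.findGreatest (fun j => M j ≤ m) m) with hK
    have hKge : 6 * (j * D) + 1 ≤ K := by omega
    have hr : 8 * (j * D) + 1 ≤ m.sqrt := Nat.le_sqrt.2 (by omega)
    have hrr : m.sqrt * m.sqrt ≤ m := Nat.sqrt_le m
    have h1 : K * (3 * m / K) ≤ 3 * m := Nat.mul_div_le _ _
    rw [← mul_assoc]
    clear_value K
    generalize 3 * m / K = v at *
    generalize m.sqrt = r at *
    generalize j * D = a at *
    have h2 : 6 * a * v ≤ 3 * m := le_trans (Nat.mul_le_mul_right v (by omega)) h1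
    have h3 : (8 * a + 1) * r ≤ m := le_trans (Nat.mul_le_mul_right r hr) hrr
    have h4 : a ≤ a * r := Nat.le_mul_of_pos_right _ (by omega)
    have e1 : a * (2 + 2 * r + v) = 2 * a + 2 * (a * r) + a * v := by ring
    have e2 : (8 * a + 1) * r = 8 * (a * r) + r := by ring
    have e3 : 6 * a * v = 6 * (a * v) := by ring
    omega

/-- The program works with the weight `w`, whereas the time bound must depend on the size `m`. The
`K` computed from `m` is at most `k`, so e ≤ w/k + 1 ≤ 3m/K + 1. -/
theorem two_pow_slowExponent_ge {D m k e w : ℕ} {M : ℕ → ℕ} (hmw : m ≤ w) (hw : w ≤ 3 * m)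
    (hk : ∀ j, M j ≤ w → j ≤ k) (hk₀ : 0 < k) (hke : k * e < w + k) :
    (2 * (m + 1) * 2 ^ e) ^ D ≤ 2 ^ slowExponent D M m := by
  classical
  unfold slowExponent
  set K := max 1 (Nat.findGreatest (fun j => M j ≤ m) m) with hK
  have hKk : K ≤ k := by
    rcases Nat.eq_zero_or_pos (Nat.findGreatest (fun j => M j ≤ m) m) with h | h
    · rw [hK, h]
      omega
    · have := Nat.findGreatest_of_ne_zero (P := fun j => M j ≤ m) rfl h.ne'
      have := hk _ (this.trans hmw)
      omega
  have he : e ≤ 3 * m / K + 1 := by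
    rcases e with - | e
    · exact Nat.zero_le _
    · refine Nat.succ_le_succ ((Nat.le_div_iff_mul_le (by omega)).2 ?_)
      have : e * K ≤ k * e := by rw [mul_comm]; exact Nat.mul_le_mul_right _ hKk
      rw [Nat.mul_succ] at hke
      omega
  calc (2 * (m + 1) * 2 ^ e) ^ D ≤ (2 * 2 ^ (2 * m.sqrt) * 2 ^ (3 * m / K + 1)) ^ D := by
        gcongr
        · exact le_two_pow_sqrt m
        · norm_num
    _ = 2 ^ (D * (2 + 2 * m.sqrt + 3 * m / K)) := by
        rw [← pow_succ', ← pow_add, ← pow_mul]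
        congr 1
        ring

variable {𝒢 : GateSet}

theorem Circuit.size_le_weight (C : Circuit 𝒢) : C.size ≤ C.weight := by
  unfold Circuit.size Circuit.weight
  omega

theorem Circuit.weight_le (C : Circuit 𝒢) : C.weight ≤ 3 * C.size := by
  have := C.out.isLt
  unfold Circuit.size Circuit.weight
  omega

/-- The running time of the fixed-parameter algorithm on the prepared instance. -/
theorem exists_time_bound (A : ℕ) (f : ℕ → ℕ) (q : Polynomial ℕ) :
    ∃ D, ∀ (C : Circuit 𝒢) (k e : ℕ), C.Valid → k ≤ C.weight + 1 → f k ≤ C.weight + f 1 →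
      A * (C.encode.length + C.weight + 1) ^ 2 * 2 ^ e +
        f k * q.eval (encNat k ++ encNat (2 ^ e) ++ C.encode).length + 1 ≤
          (2 * (C.size + 1) * 2 ^ e) ^ D := by
  set a := 𝒢.num₁ + 𝒢.num₂ + 20 with ha
  refine ⟨(A + (a + 7) * 2 + 1) + ((4 + f 1) + (q.eval 1 + (a + 12) * q.natDegree)) + 2,
    fun C k e hC hk hf => ?_⟩
  have hl := Circuit.length_encode_le hC
  have hw := C.weight_le
  simp only [List.length_append, length_encNat]
  generalize C.encode.length = l at *
  generalize C.weight = w at *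
  generalize C.size = s at *
  rw [← ha] at hl
  have hE : 1 ≤ 2 ^ e := Nat.one_le_two_pow
  generalize 2 ^ e = E at *
  -- `z` dominates `s + 1`, `E` and `2`, so that also `c ≤ z ^ c` for every constant `c`; thus every
  -- factor is at most a fixed power of `z`.
  set z := 2 * (s + 1) * E with hz
  have hsz : s + 1 ≤ z := by nlinarith
  have hEz : E ≤ z := by nlinarith
  have hz2 : 2 ≤ z := by nlinarith
  have hc : ∀ c, c ≤ z ^ c := fun c =>
    (Nat.lt_two_pow_self (n := c)).le.trans (Nat.pow_le_pow_left hz2 c)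
  have hs3 : (s + 1) ^ 3 ≤ z ^ 3 := Nat.pow_le_pow_left hsz 3
  have h1 : l + w + 1 ≤ z ^ (a + 7) := by
    calc l + w + 1 ≤ (a + 4) * (s + 1) ^ 3 := by nlinarith [Nat.zero_le (s ^ 3), Nat.zero_le (s ^ 2)]
      _ ≤ z ^ (a + 4) * z ^ 3 := Nat.mul_le_mul (hc _) hs3
      _ = z ^ (a + 7) := by rw [← pow_add]
  have h2 : A * (l + w + 1) ^ 2 * E ≤ z ^ (A + (a + 7) * 2 + 1) := by
    rw [pow_add, pow_add, pow_mul, pow_one]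
    exact Nat.mul_le_mul (Nat.mul_le_mul (hc A) (Nat.pow_le_pow_left h1 2)) hEz
  have h3 : k + 1 + (E + 1) + l ≤ z ^ (a + 12) := by
    have hks : k + 2 ≤ 3 * (s + 1) := by omega
    have hs1 : s + 1 ≤ (s + 1) ^ 3 := Nat.le_self_pow (by norm_num) _
    calc k + 1 + (E + 1) + l ≤ (a + 3) * (s + 1) ^ 3 + E := by nlinarith
      _ ≤ z ^ (a + 3) * z ^ 3 + z ^ (a + 6) := by
          refine Nat.add_le_add (Nat.mul_le_mul (hc _) hs3) (hEz.trans (Nat.le_self_pow (by omega) _))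
      _ = 2 * z ^ (a + 6) := by rw [← pow_add]; ring
      _ ≤ z * z ^ (a + 6) := Nat.mul_le_mul_right _ hz2
      _ = z ^ (a + 7) := by rw [← pow_succ']
      _ ≤ z ^ (a + 12) := Nat.pow_le_pow_right (by omega) (by omega)
  have h4 : f k * q.eval (k + 1 + (E + 1) + l) ≤
      z ^ ((4 + f 1) + (q.eval 1 + (a + 12) * q.natDegree)) := by
    rw [pow_add, pow_add z (q.eval 1), pow_mul]
    refine Nat.mul_le_mul ?_ ((polynomial_eval_le q h3 (Nat.one_le_pow _ _ (by omega))).trans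
      (Nat.mul_le_mul_right _ (hc _)))
    calc f k ≤ (3 + f 1) * (s + 1) := by nlinarith
      _ ≤ z ^ (3 + f 1) * z := Nat.mul_le_mul (hc _) hsz
      _ = z ^ (4 + f 1) := by rw [← pow_succ]; congr 1; ring
  generalize A + (a + 7) * 2 + 1 = b at *
  generalize (4 + f 1) + (q.eval 1 + (a + 12) * q.natDegree) = d at *
  have h5 : z ^ b ≤ z ^ (b + d) := Nat.pow_le_pow_right (by omega) (by omega)
  have h6 : z ^ d ≤ z ^ (b + d) := Nat.pow_le_pow_right (by omega) (by omega)
  have h7 : 1 ≤ z ^ (b + d) := Nat.one_le_pow _ _ (by omega)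
  have h8 : z ^ (b + d + 2) = z ^ (b + d) * (z * z) := by ring
  have h9 : z ^ (b + d) * 4 ≤ z ^ (b + d) * (z * z) :=
    Nat.mul_le_mul_left _ (Nat.mul_le_mul hz2 hz2)
  omega

theorem subexpSolvable_of_QM_subset (h : QM 𝒢 1 ⊆ FPQT) {c s : ℕ → unitInterval}
    (hcs : Admissible c s) : SubexpSolvable 𝒢 c s := by
  intro ε hε
  obtain ⟨-, hP⟩ := h (miniQCSAT_mem_QM 1 hcs)
  obtain ⟨p, f, q, hf, hyes, hno⟩ := hP ε hε
  obtain ⟨P, A, M, hM, hprep⟩ := exists_prepare (𝒢 := 𝒢) hf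
  obtain ⟨D, hD⟩ := exists_time_bound (𝒢 := 𝒢) A f q
  refine ⟨.seq P p, slowExponent D M, effLittleO_slowExponent D hM, fun C hC hweft => ?_⟩
  obtain ⟨k, e, hk, hkw, hfk, hMk, he, he', hexec⟩ := hprep C
  have hsize := C.size_le_weight
  set x := encNat k ++ encNat (2 ^ e) ++ C.encode with hx
  -- The size condition reads size ≤ weight ≤ k · e = k · log₂ (2^e).
  have hinst : MiniInstance 𝒢 1 x k (2 ^ e) C := by
    refine ⟨rfl, hk, by positivity, hC, hweft, ?_⟩
    rw [Nat.cast_pow, Nat.cast_ofNat, Real.logb_pow, Real.logb_self_eq_one (by norm_num), mul_one]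
    exact_mod_cast hsize.trans he
  have hparam := hinst.param_eq c s
  have htime : A * (C.encode.length + C.weight + 1) ^ 2 * 2 ^ e + f k * q.eval x.length + 1 ≤
      2 ^ slowExponent D M C.size :=
    (hD C k e hC hkw hfk).trans (two_pow_slowExponent_ge hsize C.weight_le hMk hk he')
  have hle : ∀ y, p.outProb x (f k * q.eval x.length) y ≤
      (Prog.seq P p).outProb C.encode (2 ^ slowExponent D M C.size) y := fun y =>
    (hexec.outProb_seq_le _ y).trans (outProb_mono _ _ _ htime)
  refine ⟨fun hy => ?_, fun hn => ?_⟩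
  · have := hyes x ⟨k, 2 ^ e, C, hinst, hy⟩
    rw [hparam] at this
    exact this.trans (hle _)
  · have := hno x ⟨k, 2 ^ e, C, hinst, hn⟩
    rw [hparam] at this
    exact this.trans (hle _)

end QPC

namespace QPC

/-! ## From subexponential to fixed-parameter algorithms -/

/-- All registers that a program mentions are below this bound. -/
def Prog.regBound : Prog → ℕ
  | .push r _ => r + 1
  | .pop r => r + 1
  | .had r => r + 1
  | .tgate r => r + 1
  | .cnot r r' => max r r' + 1
  | .measure r r' => max r r' + 1
  | .reset => 0
  | .skip => 0
  | .seq p q => max p.regBound q.regBound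
  | .ifTrue r p q => max (r + 1) (max p.regBound q.regBound)
  | .whileNonempty r p => max (r + 1) p.regBound

/-- An arbitrary program leaves garbage in finitely many registers only, so a fixed program can
clean up before the next one starts. -/
theorem reg_eq_of_regBound_le {N T : ℕ} {κ κ' : Config} (h : κ' ∈ steps T κ)
    (hN : ∀ p ∈ κ.todo, p.regBound ≤ N) {r : ℕ} (hr : N ≤ r) : κ'.reg r = κ.reg r := by
  induction T generalizing κ with
  | zero =>
    obtain rfl := List.mem_singleton.1 h
    rfl
  | succ T ih =>
    obtain ⟨κ₁, h₁, h⟩ := List.mem_flatMap.1 h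
    suffices H : (∀ p ∈ κ₁.todo, p.regBound ≤ N) ∧ κ₁.reg r = κ.reg r by
      rw [ih h H.1, H.2]
    obtain ⟨K, σ, ψ⟩ := κ
    rcases K with _ | ⟨p, K⟩
    · simp only [step, List.mem_singleton] at h₁
      simp [h₁]
    · obtain ⟨hp, hK⟩ := List.forall_mem_cons.1 hN
      cases p <;> simp only [step] at h₁ <;> (try split_ifs at h₁) <;>
        simp only [List.mem_cons, List.not_mem_nil, or_false] at h₁ <;>
        simp only [Prog.regBound] at hp
      case measure => rcases h₁ with rfl | rfl <;> exact ⟨hK, Function.update_of_ne (by omega) ..⟩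
      all_goals subst h₁
      case push => exact ⟨hK, Function.update_of_ne (by omega) ..⟩
      case pop => exact ⟨hK, Function.update_of_ne (by omega) ..⟩
      all_goals
        refine ⟨?_, rfl⟩
        simp only [List.forall_mem_cons, Prog.regBound]
        first
        | exact hK
        | exact ⟨by omega, hK⟩
        | exact ⟨by omega, by omega, hK⟩

/-! ### Handing the computed circuit to a second program -/

/-- Remove a unary number from register `1`. -/
def dropNat : Prog :=
  .seq (.push 3 true) (.whileNonempty 3 (.ifTrue 1 (.pop 1) (.seq (.pop 1) (.pop 3))))

theorem exec_dropNat (n : ℕ) (l : List Bool) :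
    Exec dropNat (mem [[], encNat n ++ l, [], []]) (mem [[], l, [], []]) (3 * n + 8) := by
  suffices H : Exec (.whileNonempty 3 (.ifTrue 1 (.pop 1) (.seq (.pop 1) (.pop 3))))
      (mem [[], encNat n ++ l, [], [true]]) (mem [[], l, [], []]) (3 * n + 6) from
    ((exec_push_mem _ 3 true (by simp)).seq H).mono (by omega)
  induction n with
  | zero =>
    exact (Exec.while_cons (by simp [mem]) (Exec.ifTrue_neg (by simp [mem, encNat])
      ((exec_pop_mem _ 1 (by simp)).seq (exec_pop_mem _ 3 (by simp))))
      (Exec.while_nil (by simp [mem]))).congr (by simp [encNat]) (by omega)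
  | succ n ih =>
    exact (Exec.while_cons (by simp [mem]) (Exec.ifTrue_pos (by simp [mem, encNat_succ])
      (exec_pop_mem _ 1 (by simp))) ih).mono (by omega)

/-- Erase all registers below `N` except register `1`, and replace the instance in register `1` by
the circuit in register `0`. -/
def extractCircuit (N : ℕ) : Prog :=
  .seq (clear 0) (.seq (clearRange 2 N) (.seq dropNat (.seq dropNat
    (.seq (moveRev 1 2) (moveRev 2 0)))))

theorem exec_extractCircuit {N L k n : ℕ} {σ : ℕ → List Bool} {y : List Bool}
    (hN : ∀ r ≥ N, σ r = []) (hL : ∀ r, (σ r).length ≤ L)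
    (h : σ 1 = encNat k ++ encNat n ++ y) :
    Exec (extractCircuit N) σ (inputRegs y) ((2 * N + 40) * (L + 1)) := by
  have h₁ := exec_clear 0 σ
  have h₂ := exec_clearRange 2 N L (Function.update σ 0 []) fun r => by
    rw [Function.update_apply]
    split_ifs
    · simp
    · exact hL r
  have e : (fun r => if 2 ≤ r ∧ r < 2 + N then [] else Function.update σ 0 [] r) =
      mem [[], encNat k ++ (encNat n ++ y), [], []] := by
    ext1 r
    rcases r with - | - | r
    · simp [mem]
    · simp [mem, h]
    · have h0 : mem [[], encNat k ++ (encNat n ++ y), [], []] (r + 2) = [] := by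
        rcases r with - | - | r <;> rfl
      rw [h0]
      split_ifs with hr
      · rfl
      · rw [Function.update_of_ne (by omega), hN _ (by omega)]
  rw [e] at h₂
  have h₃ : Exec (.seq (moveRev 1 2) (moveRev 2 0)) (mem [[], y, [], []]) (inputRegs y)
      (10 * y.length + 3) := by
    rw [inputRegs_eq_mem y 3]
    refine ((exec_moveRev_mem _ 1 2 (by simp) (by simp) (by simp)).seq
      (exec_moveRev_mem _ 2 0 (by simp) (by simp) (by simp))).congr ?_ ?_
    · simp
    · simp; omega
  refine (h₁.seq (h₂.seq ((exec_dropNat k _).seq ((exec_dropNat n y).seq h₃)))).mono ?_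
  have l0 := hL 0
  have l1 := hL 1
  rw [h] at l1
  simp only [List.length_append, length_encNat] at l1
  have e1 : (2 * N + 40) * (L + 1) = N * (2 * L + 2) + 40 * L + 40 := by ring
  omega

/-- A probabilistic step: compute an instance `R` with `p`, extract its circuit and run `p'`. -/
theorem outProb_compose {p p' : Prog} {x y z : List Bool} {k n T T' : ℕ} {δ : ℝ}
    (hp : 0 < p.outProb x T (encNat k ++ encNat n ++ y))
    (hp' : δ ≤ p'.outProb y T' z) :
    n ≤ x.length + T ∧
    δ * p.outProb x T (encNat k ++ encNat n ++ y) ≤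
      (Prog.seq p (.seq (extractCircuit (p.regBound + 1)) (.seq .reset p'))).outProb x
        (T + ((2 * (p.regBound + 1) + 40) * (x.length + T + 1) + T' + 3) + 1) z := by
  have hlen0 : ∀ r, (inputRegs x r).length ≤ x.length := fun r => by
    unfold inputRegs
    rw [Function.update_apply]
    split_ifs <;> simp
  have hlen : ∀ κ ∈ steps T ⟨[p], inputRegs x, QMem.zero⟩, ∀ r, (κ.reg r).length ≤ x.length + T :=
    fun κ hκ r => (length_reg_le hκ r).trans (Nat.add_le_add_right (hlen0 r) T)
  constructor
  -- An output with a longer unary block cannot be written in `T` steps, so it would have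
  -- probability zero.
  · by_contra hn
    refine hp.ne' ?_
    rw [outProb_eq_haltWeight]
    refine List.sum_eq_zero fun w hw => ?_
    obtain ⟨κ, hκ, rfl⟩ := List.mem_map.1 hw
    rw [if_neg]
    rintro ⟨-, h⟩
    have := hlen κ hκ 1
    rw [h] at this
    simp only [List.length_append, length_encNat] at this
    omega
  · rw [outProb_eq_haltWeight, outProb_eq_haltWeight, haltWeight_succ]
    simp only [step, List.map_cons, List.map_nil, List.sum_cons, List.sum_nil, add_zero]
    refine haltWeight_append (I := fun σ => (∀ r ≥ p.regBound + 1, σ r = []) ∧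
      ∀ r, (σ r).length ≤ x.length + T) (fun σ ψ hσ hI => ?_) T [p] _ _ fun κ hκ =>
      ⟨fun r hr => ?_, hlen κ hκ⟩
    · have hy := exec_extractCircuit hI.1 hI.2 hσ
      rw [Nat.add_assoc, show T' + 3 = T' + 2 + 1 from rfl, ← Nat.add_assoc, haltWeight_succ]
      simp only [step, List.map_cons, List.map_nil, List.sum_cons, List.sum_nil, add_zero]
      refine le_trans ?_ (hy.haltWeight_le _ (T' + 2) [.seq .reset p'] ψ)
      rw [haltWeight_succ]
      simp only [step, List.map_cons, List.map_nil, List.sum_cons, List.sum_nil, add_zero]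
      rw [haltWeight_succ]
      simp only [step, List.map_cons, List.map_nil, List.sum_cons, List.sum_nil, add_zero]
      -- After the reset the state is √‖ψ‖² times the initial one, so the branch contributes its
      -- weight times the success probability of a fresh run of `p'`.
      rw [QMem.reset_eq, haltWeight_smul _ (Real.sqrt_nonneg _), Real.sq_sqrt ψ.normSq_nonneg,
        ← outProb_eq_haltWeight, mul_comm]
      exact mul_le_mul_of_nonneg_left hp' ψ.normSq_nonneg
    · rw [reg_eq_of_regBound_le (N := p.regBound + 1) hκ (by simp) hr]
      have hr₀ : r ≠ 0 := by omega
      simp [inputRegs, Function.update_of_ne hr₀]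

/-- For m ≥ M(k), k·h(m) ≤ m ≤ k log n. For smaller m, either m ≥ M(1) and h(m) ≤ m < M(k), or m is
one of finitely many values, whose h enters as a constant. So no computability of `h` is needed. -/
theorem two_pow_le_of_effLittleO {h M : ℕ → ℕ} (hM : ∀ k n, M k ≤ n → k * h n ≤ n) {k n m : ℕ}
    (hk : 0 < k) (hn : 0 < n) (hm : (m : ℝ) ≤ k * Real.logb 2 n) :
    2 ^ h m ≤ 2 ^ (M k + ∑ i ∈ Finset.range (M 1), h i) * n := by
  by_cases hkm : M k ≤ m
  · refine le_trans ?_ (Nat.le_mul_of_pos_left n (by positivity))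
    have h1 : (k : ℝ) * h m ≤ k * Real.logb 2 n := by
      refine le_trans ?_ hm
      exact_mod_cast hM k m hkm
    have h2 : (h m : ℝ) ≤ Real.logb 2 n := le_of_mul_le_mul_left h1 (by exact_mod_cast hk)
    rw [Real.le_logb_iff_rpow_le (by norm_num) (by exact_mod_cast hn), Real.rpow_natCast] at h2
    exact_mod_cast h2
  · refine le_trans (Nat.pow_le_pow_right (by norm_num) ?_) (Nat.le_mul_of_pos_right _ hn)
    by_cases h1 : M 1 ≤ m
    · have := hM 1 m h1
      omega
    · have := Finset.single_le_sum (f := h) (fun i _ => Nat.zero_le _)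
        (Finset.mem_range.2 (show m < M 1 by omega))
      omega

theorem computable_two_pow : Computable fun n : ℕ => 2 ^ n := by
  refine (Computable.nat_rec (f := fun n : ℕ => n) (g := fun _ => 1)
    (h := fun _ (p : ℕ × ℕ) => p.2 * 2) Computable.id (Computable.const 1) ?_).of_eq fun n => ?_
  · exact (Primrec.nat_mul.to_comp.comp (Computable.snd.comp Computable.snd)
      (Computable.const 2)).to₂
  · induction n with
    | zero => rfl
    | succ n ih => rw [pow_succ, ← ih]

variable {𝒢 : GateSet}

theorem mem_FPQT_of_subexpSolvable {c s : ℕ → unitInterval} (hcs : SubexpSolvable 𝒢 c s)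
    {P : ParamProblem} (hP : P ∈ QMcs 𝒢 1 c s) : P ∈ FPQT := by
  obtain ⟨hwf, R, g, hg, hRyes, hRno, hRparam, hR⟩ := hP
  refine ⟨hwf, fun ε hε => ?_⟩
  -- Two phases with error δ give (1 - δ)² ≥ 1 - 2δ ≥ 1 - ε. The minimum with `1` keeps 1 - δ
  -- positive, so the reduction's output has positive probability.
  set δ := min ε 1 / 2 with hδ
  have hδ₀ : 0 < δ := by positivity
  have hδ₁ : δ ≤ 1 / 2 := by
    have := min_le_right ε 1
    linarith
  have hδε : 1 - ε ≤ (1 - δ) * (1 - δ) := by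
    have := min_le_left ε 1
    nlinarith
  obtain ⟨p, f, q, hf, hp⟩ := hR δ hδ₀
  obtain ⟨p', h, ⟨M, hM, hMh⟩, hp'⟩ := hcs δ hδ₀
  set H := ∑ i ∈ Finset.range (M 1), h i with hH
  set N := p.regBound + 1 with hN
  -- Only `k ≤ g κ` is known and `M` need not be monotone; the sum is a computable bound for all `M
  -- k` in this range.
  set S : ℕ → ℕ := fun κ => ∑ i ∈ Finset.range (g κ + 1), M i with hS
  have key : ∀ x ∈ P.yes ∪ P.no, ∀ (k n : ℕ) (C : Circuit 𝒢) (z : List Bool),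
      MiniInstance 𝒢 1 (R x) k n C → 1 - δ ≤ p'.outProb C.encode (2 ^ h C.size) z →
      1 - ε ≤ (Prog.seq p (.seq (extractCircuit N) (.seq .reset p'))).outProb x
        ((f (P.param x) + 1) * (2 * N + 50 + 2 ^ (S (P.param x) + H)) *
          (Polynomial.X + q + 1).eval x.length) z := by
    intro x hx k n C z hinst hz
    have h₁ := hp x hx
    rw [hinst.1] at h₁
    obtain ⟨hn, hcomp⟩ := outProb_compose (by linarith) hz (k := k) (n := n)
    refine hδε.trans ((mul_le_mul_of_nonneg_left h₁ (by linarith)).trans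
      (hcomp.trans (outProb_mono _ _ _ ?_)))
    have hkg : k ≤ g (P.param x) := by
      have := hRparam x hx
      rwa [hinst.param_eq] at this
    have hMS : M k ≤ S (P.param x) := Finset.single_le_sum (f := M) (fun i _ => Nat.zero_le _)
      (Finset.mem_range.2 (by omega))
    have htime := two_pow_le_of_effLittleO hMh hinst.2.1 hinst.2.2.1 hinst.2.2.2.2.2
    rw [← hH] at htime
    have hpow : 2 ^ (M k + H) ≤ 2 ^ (S (P.param x) + H) :=
      Nat.pow_le_pow_right (by norm_num) (by omega)
    rw [Polynomial.eval_add, Polynomial.eval_add, Polynomial.eval_X, Polynomial.eval_one]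
    rw [← hN]
    generalize 2 ^ (S (P.param x) + H) = E at *
    generalize f (P.param x) = a at *
    generalize q.eval x.length = b at *
    generalize x.length = l at *
    have h1 : 2 ^ h C.size ≤ E * (l + a * b) := htime.trans (Nat.mul_le_mul hpow hn)
    have h2 : l + a * b + 1 ≤ (a + 1) * (l + b + 1) := by nlinarith [Nat.zero_le (a * l)]
    calc a * b + ((2 * N + 40) * (l + a * b + 1) + 2 ^ h C.size + 3) + 1
        ≤ (2 * N + 50 + E) * (l + a * b + 1) := by nlinarith
      _ ≤ (2 * N + 50 + E) * ((a + 1) * (l + b + 1)) := Nat.mul_le_mul_left _ h2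
      _ = (a + 1) * (2 * N + 50 + E) * (l + b + 1) := by ring
  refine ⟨.seq p (.seq (extractCircuit N) (.seq .reset p')), fun κ => (f κ + 1) * (2 * N + 50 + 2 ^ (S κ + H)), Polynomial.X + q + 1, ?_,
    fun x hx => ?_, fun x hx => ?_⟩
  · have cS : Computable S := (computable_sum_range hM).comp (Computable.succ.comp hg)
    exact Primrec.nat_mul.to_comp.comp (Computable.succ.comp hf) (Primrec.nat_add.to_comp.comp
      (Computable.const _) (computable_two_pow.comp (Primrec.nat_add.to_comp.comp cS
        (Computable.const _))))
  · obtain ⟨k, n, C, hinst, hy⟩ := hRyes x hx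
    exact key x (Or.inl hx) k n C _ hinst ((hp' C hinst.2.2.2.1 hinst.2.2.2.2.1).1 hy)
  · obtain ⟨k, n, C, hinst, hy⟩ := hRno x hx
    exact key x (Or.inr hx) k n C _ hinst ((hp' C hinst.2.2.2.1 hinst.2.2.2.2.1).2 hy)

end QPC

theorem mainTheorem4 (𝒢 : QPC.GateSet) : QPC.QM 𝒢 1 ⊆ QPC.FPQT ↔ ¬ QPC.QETH 𝒢 := by
  constructor
  · rintro h ⟨c, s, hcs, hns⟩
    exact hns (QPC.subexpSolvable_of_QM_subset h hcs)
  · rintro h P ⟨c, s, hcs, hP⟩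
    refine QPC.mem_FPQT_of_subexpSolvable ?_ hP
    by_contra hns
    exact h ⟨c, s, hcs, hns⟩
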